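/- For real $a,b$ let $\varphi_{a,b}(x,y)=(y,\;a-bx+y^2)$, $y_{a,b}=\tfrac12\bigl(1+b+\sqrt{(1+b)^2-4a}\bigr)$, and let $p_{a,b}=(y_{a,b},y_{a,b})$, a fixed point of $\varphi_{a,b}$. Let $W^s(p_{a,b})$ be the set of points whose forward orbit tends to $p_{a,b}$ and $W^u(p_{a,b})$ the set of points having a backward orbit that tends to $p_{a,b}$. **Definitions.** Let $A,B$ be curves in the plane. A point $z$ is a *transverse intersection* of $A$ and $B$ if there are smooth arcs in $A$ and in $B$ through $z$ with linearly independent velocities at $z$. A point $q$ is a *quadratic tangency* of $A$ and $B$ if there are an open set $O\ni q$, $C^3$ coordinates $(x,y)$ on $O$ with $q=(0,0)$, smooth embedded arcs $L^A\subset A$, $L^B\subset B$ and a constant $c\ne0$ with $L^A\cap O=\{y=0\}$ and $L^B\cap O=\{y=cx^2\}$. If $A=A_t$, $B=B_t$ depend on a real parameter $t$, a quadratic tangency $q$ of $A_{t_0}$ and $B_{t_0}$ *unfolds generically* if for $t$ near $t_0$ there are coordinates on a fixed open set $O\ni q$, depending $C^3$ on $t$ (jointly with the point) and centred at $q$ for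 $t=t_0$, embedded arcs $L^A_t\subset A_t$, $L^B_t\subset B_t$ depending smoothly on $t$, a constant $c\neq 0$ and a $C^1$ function $\beta$ with $\beta(t_0)=0$, $\beta'(t_0)\ne0$ such that $L^A_t\cap O=\{y=0\}$ and $L^B_t\cap O=\{y=cx^2+\beta(t)\}$ for all $t$ near $t_0$. **Statement.** There are $r,\delta>0$ such that, writing $N=\{(a,b):|a+2|<r,\ |b|<r\}$, the following hold. 1. There are functions $\eta_{a,b}(x)$ ($|x|\le 5/2$), $\xi_{a,b}(x)$ ($-7/4\le x\le y_{a,b}$) and $\zeta_{a,b}(t)$ ($|t|\le\delta$), each $C^\infty$ jointly in its variable and $(a,b)\in N$, such that for all $(a,b)\in N$: the graph of $\eta_{a,b}$ contains $p_{a,b}$ and lies in $W^s(p_{a,b})$; the graph of $\xi_{a,b}$ has $p_{a,b}$ as its right end point and lies in $W^u(p_{a,b})$; the graph of $\zeta_{a,b}$ lies in the $\varphi_{a,b}$-image of the part $-7/4\le x\le -5/4$ of the graph of $\xi_{a,b}$; and $|\zeta_{a,b}(t)|\le 5/2$ for $|t|\le\delta$. For $(a,b)\in N$ with $b\ne0$,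 $p_{a,b}$ is a dissipative saddle fixed point, that is, the derivative of $\varphi_{a,b}$ at $p_{a,b}$ has eigenvalues $\lambda,\sigma$ with $0<|\lambda|<1<\sigma$ and $|\lambda|\sigma<1$. 2. For $(a,b)\in N$ the function $\theta_{a,b}(t)=a-bt+\zeta_{a,b}(t)^2-\eta_{a,b}(\zeta_{a,b}(t))$ on $[-\delta,\delta]$ attains its maximum at a unique point $t_{a,b}$, and $t_{a,b}\in(-\delta,\delta)$. The height function $H(a,b)=\theta_{a,b}(t_{a,b})$ and the point $q_{a,b}=\varphi_{a,b}(t_{a,b},\zeta_{a,b}(t_{a,b}))$ are $C^\infty$ in $(a,b)\in N$, and $q_{-2,0}=(-2,2)$. 3. There are $\varepsilon>0$ and a $C^\infty$ function $h:(-\varepsilon,\varepsilon)\to\mathbb R$ with $h(0)=-2$ such that for every $b\in(-\varepsilon,\varepsilon)$: $(h(b),b)\in N$, $H(h(b),b)=0$, $\frac{\partial H}{\partial a}(h(b),b)\neq0$ and $\theta_{h(b),b}''(t_{h(b),b})\ne0$. 4. For every $b\in(-\varepsilon,\varepsilon)$ with $b\neq0$: $W^u(p_{h(b),b})$ and $W^s(p_{h(b),b})$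 have a transverse intersection different from $p_{h(b),b}$; moreover $q_{h(b),b}$ is a quadratic tangency of $W^s(p_{h(b),b})$ and $W^u(p_{h(b),b})$, and it unfolds generically with respect to the $a$-parameter family $\{\varphi_{a,b}\}$ with $b$ fixed, that is, for the curves $W^s(p_{a,b})$, $W^u(p_{a,b})$ with parameter $a$ near $h(b)$. -/

import Mathlib

open Set Filter Topology
open scoped ContDiff

noncomputable section

namespace Henon

/-- The (conjugated) Hénon map `φ_{a,b}(x, y) = (y, a - b x + y²)`. -/
def phi (a b : ℝ) (z : ℝ × ℝ) : ℝ × ℝ := (z.2, a - b * z.1 + z.2 ^ 2)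

/-- The common coordinate `y_{a,b} = (1 + b + √((1 + b)² - 4a)) / 2` of the fixed point. -/
def yFix (a b : ℝ) : ℝ := (1 + b + Real.sqrt ((1 + b) ^ 2 - 4 * a)) / 2

/-- The fixed point `p_{a,b} = (y_{a,b}, y_{a,b})`. -/
def pFix (a b : ℝ) : ℝ × ℝ := (yFix a b, yFix a b)

/-- The stable manifold of a fixed point `p` of `f`: the points whose forward orbit tends
to `p`. -/
def stableSet (f : ℝ × ℝ → ℝ × ℝ) (p : ℝ × ℝ) : Set (ℝ × ℝ) :=
  {z | Tendsto (fun n : ℕ => f^[n] z) atTop (𝓝 p)}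

/-- The unstable manifold of a fixed point `p` of `f` (`f` need not be invertible): the points
that have a backward orbit tending to `p`. -/
def unstableSet (f : ℝ × ℝ → ℝ × ℝ) (p : ℝ × ℝ) : Set (ℝ × ℝ) :=
  {z | ∃ w : ℕ → ℝ × ℝ, w 0 = z ∧ (∀ n, f (w (n + 1)) = w n) ∧ Tendsto w atTop (𝓝 p)}

/-- `W^s(p_{a,b})`. -/
def Ws (a b : ℝ) : Set (ℝ × ℝ) := stableSet (phi a b) (pFix a b)

/-- `W^u(p_{a,b})`. -/
def Wu (a b : ℝ) : Set (ℝ × ℝ) := unstableSet (phi a b) (pFix a b)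

/-- `p` is a dissipative saddle fixed point of `f`: the eigenvalues `lam`, `sig` of the
derivative satisfy `0 < |lam| < 1 < sig` and `|lam| sig < 1`. -/
def IsDissipativeSaddle (f : ℝ × ℝ → ℝ × ℝ) (p : ℝ × ℝ) : Prop :=
  f p = p ∧ DifferentiableAt ℝ f p ∧ ∃ lam sig : ℝ,
    Module.End.HasEigenvalue (fderiv ℝ f p : (ℝ × ℝ) →ₗ[ℝ] (ℝ × ℝ)) lam ∧
    Module.End.HasEigenvalue (fderiv ℝ f p : (ℝ × ℝ) →ₗ[ℝ] (ℝ × ℝ)) sig ∧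
    0 < |lam| ∧ |lam| < 1 ∧ 1 < sig ∧ |lam| * sig < 1

/-! ### Arcs, transverse intersections, quadratic tangencies -/

/-- `z` is a transverse intersection point of the curves `A` and `B`: there are smooth arcs in `A`
and in `B` through `z` whose velocity vectors at `z` are linearly independent. -/
def IsTransverseIntersection (A B : Set (ℝ × ℝ)) (z : ℝ × ℝ) : Prop :=
  ∃ α β : ℝ → ℝ × ℝ,
    ContDiffOn ℝ ∞ α (Ioo (-1) 1) ∧ ContDiffOn ℝ ∞ β (Ioo (-1) 1) ∧
    α '' Ioo (-1) 1 ⊆ A ∧ β '' Ioo (-1) 1 ⊆ B ∧ α 0 = z ∧ β 0 = z ∧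
    LinearIndependent ℝ ![deriv α 0, deriv β 0]

/-- For `t ∈ J` the curve `γ t`, restricted to `[-1, 1]`, parametrizes a smoothly embedded compact
arc in `W t`, and these arcs depend smoothly on `t`. -/
def IsArcFamily (W : ℝ → Set (ℝ × ℝ)) (J : Set ℝ) (γ : ℝ → ℝ → ℝ × ℝ) : Prop :=
  ContDiffOn ℝ ∞ (Function.uncurry γ) (J ×ˢ Icc (-1) 1) ∧
  ∀ t ∈ J, InjOn (γ t) (Icc (-1) 1) ∧
    (∀ s ∈ Icc (-1 : ℝ) 1, derivWithin (γ t) (Icc (-1) 1) s ≠ 0) ∧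
    γ t '' Icc (-1) 1 ⊆ W t

/-- For `t ∈ J` the map `Φ t` is a system of local coordinates on the open set `O`, and these
coordinates depend `C³` on `t`. -/
def IsCoordFamily (J : Set ℝ) (O : Set (ℝ × ℝ)) (Φ : ℝ → ℝ × ℝ → ℝ × ℝ) : Prop :=
  IsOpen O ∧ ContDiffOn ℝ 3 (Function.uncurry Φ) (J ×ˢ O) ∧
  ∀ t ∈ J, InjOn (Φ t) O ∧ ∀ z ∈ O, Function.Bijective (fderiv ℝ (Φ t) z)

/-- `q` is a quadratic tangency of the curves `A` and `B`: on a neighbourhood `O` of `q` there are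
coordinates, centred at `q`, in which an arc of `A` is `y = 0` and an arc of `B` is `y = c x²`
with `c ≠ 0`. (Families indexed by `univ` that do not depend on the index are single objects.) -/
def IsQuadraticTangency (A B : Set (ℝ × ℝ)) (q : ℝ × ℝ) : Prop :=
  ∃ (O : Set (ℝ × ℝ)) (Φ : ℝ × ℝ → ℝ × ℝ) (α β : ℝ → ℝ × ℝ) (c : ℝ),
    IsCoordFamily univ O (fun _ => Φ) ∧ q ∈ O ∧ Φ q = (0, 0) ∧ c ≠ 0 ∧
    IsArcFamily (fun _ => A) univ (fun _ => α) ∧ IsArcFamily (fun _ => B) univ (fun _ => β) ∧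
    (α '' Icc (-1) 1) ∩ O = {z ∈ O | (Φ z).2 = 0} ∧
    (β '' Icc (-1) 1) ∩ O = {z ∈ O | (Φ z).2 = c * (Φ z).1 ^ 2}

/-- `q` is a quadratic tangency of `A t₀` and `B t₀` that unfolds generically in the family of pairs
of curves `A t`, `B t`: for `t` near `t₀` there are coordinates on a neighbourhood `O` of `q`,
depending `C³` on `t` and centred at `q` for `t = t₀`, in which an arc of `A t` is `y = 0` and an
arc of `B t` is `y = c x² + β(t)`, where `c ≠ 0` is constant, `β` is `C¹`, `β(t₀) = 0` and
`β'(t₀) ≠ 0`. -/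
def UnfoldsGenerically (A B : ℝ → Set (ℝ × ℝ)) (t₀ : ℝ) (q : ℝ × ℝ) : Prop :=
  ∃ (κ : ℝ) (O : Set (ℝ × ℝ)) (Φ : ℝ → ℝ × ℝ → ℝ × ℝ) (γs γu : ℝ → ℝ → ℝ × ℝ) (c : ℝ)
    (β : ℝ → ℝ),
    0 < κ ∧ IsCoordFamily (Ioo (t₀ - κ) (t₀ + κ)) O Φ ∧ q ∈ O ∧ Φ t₀ q = (0, 0) ∧ c ≠ 0 ∧
    IsArcFamily A (Ioo (t₀ - κ) (t₀ + κ)) γs ∧ IsArcFamily B (Ioo (t₀ - κ) (t₀ + κ)) γu ∧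
    ContDiffOn ℝ 1 β (Ioo (t₀ - κ) (t₀ + κ)) ∧ β t₀ = 0 ∧ deriv β t₀ ≠ 0 ∧
    ∀ t ∈ Ioo (t₀ - κ) (t₀ + κ),
      (γs t '' Icc (-1) 1) ∩ O = {z ∈ O | (Φ t z).2 = 0} ∧
      (γu t '' Icc (-1) 1) ∩ O = {z ∈ O | (Φ t z).2 = c * (Φ t z).1 ^ 2 + β t}

/-! ### The height function -/

/-- The parameter square `|a + 2| < r`, `|b| < r`. -/
def params (r : ℝ) : Set (ℝ × ℝ) := Ioo (-2 - r) (-2 + r) ×ˢ Ioo (-r) r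

/-- The segments `S_{a,b} = {(x, η_{a,b}(x)) : |x| ≤ 5/2}`: they lie in `W^s(p_{a,b})`, contain
`p_{a,b}`, and depend smoothly on `(a, b)`. -/
def IsStableGraph (r : ℝ) (η : ℝ → ℝ → ℝ → ℝ) : Prop :=
  ContDiffOn ℝ ∞ (fun v : (ℝ × ℝ) × ℝ => η v.1.1 v.1.2 v.2)
    (params r ×ˢ Icc (-(5 / 2)) (5 / 2)) ∧
  ∀ a b, (a, b) ∈ params r →
    (∀ x ∈ Icc (-(5 / 2) : ℝ) (5 / 2), (x, η a b x) ∈ Ws a b) ∧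
    yFix a b ∈ Icc (-(5 / 2) : ℝ) (5 / 2) ∧ η a b (yFix a b) = yFix a b

/-- The graphs `{(x, ξ_{a,b}(x)) : -7/4 ≤ x ≤ y_{a,b}}`: they lie in `W^u(p_{a,b})`, end at
`p_{a,b}`, and depend smoothly on `(a, b)`. -/
def IsUnstableGraph (r : ℝ) (ξ : ℝ → ℝ → ℝ → ℝ) : Prop :=
  ContDiffOn ℝ ∞ (fun v : (ℝ × ℝ) × ℝ => ξ v.1.1 v.1.2 v.2)
    {v | v.1 ∈ params r ∧ v.2 ∈ Icc (-(7 / 4)) (yFix v.1.1 v.1.2)} ∧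
  ∀ a b, (a, b) ∈ params r →
    (∀ x ∈ Icc (-(7 / 4)) (yFix a b), (x, ξ a b x) ∈ Wu a b) ∧
    0 < yFix a b ∧ ξ a b (yFix a b) = yFix a b

/-- The curves `l_{a,b} = {(t, ζ_{a,b}(t)) : |t| ≤ δ}`: they depend smoothly on `(a, b)`, and
`l_{a,b}` lies in the `φ_{a,b}`-image of the part `-7/4 ≤ x ≤ -5/4` of the graph of `ξ_{a,b}`. -/
def IsReturnGraph (r δ : ℝ) (ξ ζ : ℝ → ℝ → ℝ → ℝ) : Prop :=
  ContDiffOn ℝ ∞ (fun v : (ℝ × ℝ) × ℝ => ζ v.1.1 v.1.2 v.2) (params r ×ˢ Icc (-δ) δ) ∧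
  ∀ a b, (a, b) ∈ params r → ∀ t ∈ Icc (-δ) δ,
    ∃ s ∈ Icc (-(7 / 4) : ℝ) (-(5 / 4)), phi a b (s, ξ a b s) = (t, ζ a b t)

/-- The height `θ_{a,b}(t)` of `φ_{a,b}(t, ζ_{a,b}(t))` over the graph of `η_{a,b}`. -/
def theta (η ζ : ℝ → ℝ → ℝ → ℝ) (a b t : ℝ) : ℝ :=
  (phi a b (t, ζ a b t)).2 - η a b (phi a b (t, ζ a b t)).1

/-- `τ a b` is, for all parameters, an interior point of `[-δ, δ]` and the only point where
`θ_{a,b}` attains its maximum over `[-δ, δ]`; moreover the curve `φ_{a,b}(l_{a,b})` stays in the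
strip `|x| ≤ 5/2` on which the graph of `η_{a,b}` is considered. -/
def IsTop (r δ : ℝ) (η ζ : ℝ → ℝ → ℝ → ℝ) (τ : ℝ → ℝ → ℝ) : Prop :=
  ∀ a b, (a, b) ∈ params r →
    (∀ t ∈ Icc (-δ) δ, (phi a b (t, ζ a b t)).1 ∈ Icc (-(5 / 2) : ℝ) (5 / 2)) ∧
    τ a b ∈ Ioo (-δ) δ ∧
    ∀ t ∈ Icc (-δ) δ, t ≠ τ a b → theta η ζ a b t < theta η ζ a b (τ a b)

/-- The height function `H(a, b) = θ_{a,b}(t_{a,b})`. -/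
def height (η ζ : ℝ → ℝ → ℝ → ℝ) (τ : ℝ → ℝ → ℝ) (a b : ℝ) : ℝ := theta η ζ a b (τ a b)

/-- The point `q_{a,b} = φ_{a,b}(t_{a,b}, ζ_{a,b}(t_{a,b}))`. -/
def qPoint (ζ : ℝ → ℝ → ℝ → ℝ) (τ : ℝ → ℝ → ℝ) (a b : ℝ) : ℝ × ℝ :=
  phi a b (τ a b, ζ a b (τ a b))

end Henon

end

/-! At `b = 0` everything is explicit: the stable graph is the horizontal line at height `y_{a,0}`,
the unstable graph is `x ↦ a + x²`, and the return curve is `t ↦ a + t²`. The height is `θ(t) = a +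
(a + t²)² - y_{a,0}`, which for `a = -2` is `t⁴ - 4t²`: a nondegenerate maximum of value `0` at `t =
0`. Moreover `H(a, 0) = a + a² - y_{a,0}` has derivative `-8/3` at `a = -2`. If the graphs are
smooth in `(a, b)` up to and across `b = 0`, the implicit function theorem yields the top `t_{a,b}`
from `θ' = 0` and the curve `a = h(b)` from `H = 0`.

The graphs must therefore be constructed where `φ` need not be invertible. A forward or backward
orbit staying near the fixed point is encoded by a bounded sequence of coordinates with `s_n²`
affine in its neighbours. Between suitable positive bounds, taking square roots is a contraction of
factor `1/2` (`Admissible.contractingWith`). The linearized system is invertible for the same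
reason, so the Banach space implicit function theorem makes the solution smooth in all parameters
(`contDiffAt_orbitSeq`), and the same estimate forces convergence to `y_{a,b}`
(`Admissible.tendsto_orbitSeq`).

For the generic unfolding (`unfoldsGenerically`) the coordinates are a Morse coordinate of `θ`
evaluated at the time `t` recovered from the point (possible as `b ≠ 0`), and the height over the
stable graph. In them the stable arc is `y = 0` and the unstable arc is `y = -x² + H(a, b)`. The
quadratic tangency is the case of a frozen parameter.

For the transverse intersection, the unstable set contains further sheets `t ↦ a - b k(t) + t²`
close to the return curve. One whose `b k` is larger lies below the return curve, and its image lies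
above the image of the return curve relative to the stable graph. At the parameter of tangency its
height is thus positive at the top time and negative at `t = δ`, and concavity makes the zero in
between transverse (`IsSheet.exists_transverse`). The sign of `b` decides which sheet serves
(`exists_sheets`). -/

noncomputable section

namespace Henon

/-! ### Smooth implicit functions -/

section Implicit

variable {P E F : Type*} [NormedAddCommGroup P] [NormedSpace ℝ P] [CompleteSpace P]
  [NormedAddCommGroup E] [NormedSpace ℝ E] [CompleteSpace E]
  [NormedAddCommGroup F] [NormedSpace ℝ F] [CompleteSpace F]

/-- A continuous solution of a smooth equation with invertible partial derivative is smooth. -/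
theorem contDiffAt_of_implicit {n : ℕ∞ω} (hn : n ≠ 0) {f : P × E → F} {g : P → E} {p : P}
    (hf : ContDiffAt ℝ n f (p, g p))
    (hinv : (fderiv ℝ f (p, g p) ∘L .inr ℝ P E).IsInvertible)
    (hg : ContinuousAt g p) (hfg : ∀ᶠ q in 𝓝 p, f (q, g q) = f (p, g p)) :
    ContDiffAt ℝ n g p := by
  have h1 := hf.eventually_apply_eq_iff_implicitFunction hn hinv
  have h2 : Tendsto (fun q => (q, g q)) (𝓝 p) (𝓝 (p, g p)) :=
    (continuousAt_id.prodMk hg).tendsto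
  refine (hf.contDiffAt_implicitFunction hn hinv).congr_of_eventuallyEq ?_
  filter_upwards [h2.eventually h1, hfg] with q hq hq'
  exact (hq.1 hq').symm

end Implicit

theorem isInvertible_of_apply_one_ne_zero {T : ℝ →L[ℝ] ℝ} (h : T 1 ≠ 0) : T.IsInvertible := by
  refine ⟨ContinuousLinearEquiv.unitsEquivAut ℝ (Units.mk0 (T 1) h), ?_⟩
  ext
  simp

/-- The partial derivative in the last variable. -/
def tDeriv {E : Type*} [NormedAddCommGroup E] [NormedSpace ℝ E] (f : E × ℝ → ℝ) (v : E × ℝ) : ℝ :=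
  fderiv ℝ f v (0, 1)

section TDeriv

variable {E : Type*} [NormedAddCommGroup E] [NormedSpace ℝ E] {f : E × ℝ → ℝ}

theorem hasDerivAt_tDeriv {e : E} {t : ℝ} (hf : DifferentiableAt ℝ f (e, t)) :
    HasDerivAt (fun s => f (e, s)) (tDeriv f (e, t)) t := by
  have h1 : HasDerivAt (fun s : ℝ => (e, s)) ((0 : E), (1 : ℝ)) t :=
    (hasDerivAt_const t e).prodMk (hasDerivAt_id t)
  exact hf.hasFDerivAt.comp_hasDerivAt t h1

theorem contDiffOn_tDeriv {U : Set (E × ℝ)} (hU : IsOpen U) (hf : ContDiffOn ℝ ∞ f U) :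
    ContDiffOn ℝ ∞ (tDeriv f) U :=
  ((contDiffOn_infty_iff_fderiv_of_isOpen hU).1 hf).2.clm_apply contDiffOn_const

end TDeriv

/-- The implicit function theorem for a scalar unknown, smooth on a whole neighbourhood. -/
theorem exists_implicit_real {P : Type*} [NormedAddCommGroup P] [NormedSpace ℝ P] [CompleteSpace P]
    {f : P × ℝ → ℝ} {U : Set (P × ℝ)} (hU : IsOpen U) (hf : ContDiffOn ℝ ∞ f U) {p : P} {x : ℝ}
    (hpx : (p, x) ∈ U) (hx : tDeriv f (p, x) ≠ 0) :
    ∃ (g : P → ℝ) (V : Set P), IsOpen V ∧ p ∈ V ∧ ContDiffOn ℝ ∞ g V ∧ g p = x ∧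
      ∀ q ∈ V, (q, g q) ∈ U ∧ f (q, g q) = f (p, x) := by
  have hfa : ∀ v ∈ U, ContDiffAt ℝ ∞ f v := fun v hv => hf.contDiffAt (hU.mem_nhds hv)
  have key : ∀ v, tDeriv f v ≠ 0 → (fderiv ℝ f v ∘L .inr ℝ P ℝ).IsInvertible := fun v hv =>
    isInvertible_of_apply_one_ne_zero (by simpa [tDeriv] using hv)
  have hn : (∞ : ℕ∞ω) ≠ 0 := by simp
  set g := (hfa _ hpx).implicitFunction hn (key _ hx) with hg
  have g0 : g p = x := (hfa _ hpx).implicitFunction_apply_self hn (key _ hx)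
  have gs : ContDiffAt ℝ ∞ g p := (hfa _ hpx).contDiffAt_implicitFunction hn (key _ hx)
  have ge : ∀ᶠ q in 𝓝 p, f (q, g q) = f (p, x) :=
    (hfa _ hpx).eventually_apply_implicitFunction hn (key _ hx)
  -- Being `C^∞` at `p` gives no common neighbourhood for all finite orders. Only continuity nearby
  -- is taken from it; `contDiffAt_of_implicit` then gives smoothness at each nearby point
  -- separately.
  have gc : ∀ᶠ q in 𝓝 p, ContinuousAt g q :=
    ((gs.of_le (m := 1) (by exact_mod_cast le_top)).eventually (by simp)).mono
      fun q hq => hq.continuousAt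
  have ht : Tendsto (fun q => (q, g q)) (𝓝 p) (𝓝 (p, x)) := by
    have := (continuousAt_id.prodMk gs.continuousAt).tendsto
    simpa [g0] using this
  have hd : ∀ᶠ v in 𝓝 (p, x), v ∈ U ∧ tDeriv f v ≠ 0 := by
    refine Filter.Eventually.and (hU.mem_nhds hpx) ?_
    exact ((contDiffOn_tDeriv hU hf).continuousOn.continuousAt (hU.mem_nhds hpx)).eventually_ne hx
  obtain ⟨V, hV, hVo, hpV⟩ := eventually_nhds_iff.1 ((ge.and gc).and (ht.eventually hd))
  refine ⟨g, V, hVo, hpV, fun q hq => ?_, g0, fun q hq => ⟨(hV q hq).2.1, (hV q hq).1.1⟩⟩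
  refine (contDiffAt_of_implicit hn (hfa _ (hV q hq).2.1) (key _ (hV q hq).2.2)
    (hV q hq).1.2 ?_).contDiffWithinAt
  filter_upwards [hVo.mem_nhds hq] with q' hq'
  rw [(hV q' hq').1.1, (hV q hq).1.1]

/-! ### Smooth dependence of integrals on parameters -/

section ParametricIntegral

theorem continuousOn_parametric_integral {E G : Type*} [TopologicalSpace E] [FirstCountableTopology E]
    [NormedAddCommGroup G] [NormedSpace ℝ G]
    {W : Set E} {F : E × ℝ → G} (hF : ContinuousOn F (W ×ˢ Icc 0 1)) :
    ContinuousOn (fun v => ∫ s in (0 : ℝ)..1, F (v, s)) W := by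
  rw [continuousOn_iff_continuous_domRestrict]
  -- Projecting `s` onto `[0, 1]` extends the integrand continuously to all real `s` without
  -- changing the integral.
  have h1 : Continuous (fun q : W × ℝ => F (q.1, projIcc (0 : ℝ) 1 zero_le_one q.2)) := by
    refine hF.comp_continuous (by fun_prop) fun q => ⟨q.1.2, (projIcc _ _ zero_le_one _).2⟩
  have h2 := intervalIntegral.continuous_parametric_intervalIntegral_of_continuous' (X := W)
    (μ := MeasureTheory.volume)
    (f := fun w s => F (w, projIcc (0 : ℝ) 1 zero_le_one s)) h1 0 1
  refine h2.congr fun w => ?_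
  refine intervalIntegral.integral_congr fun s hs => ?_
  rw [uIcc_of_le zero_le_one] at hs
  simp only [projIcc_of_mem _ hs]

/-- Induction on the order by differentiating under the integral. The target space `G` is quantified
inside the induction because the derivative takes values in `E →L[ℝ] G`. -/
theorem contDiffOn_parametric_integral_nat {E : Type} [NormedAddCommGroup E] [NormedSpace ℝ E]
    {D : Set (E × ℝ)} (hD : IsOpen D) {W : Set E} (hW : IsOpen W) (hWD : W ×ˢ Icc 0 1 ⊆ D)
    (n : ℕ) : ∀ {G : Type} [NormedAddCommGroup G] [NormedSpace ℝ G]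
    {F : E × ℝ → G}, ContDiffOn ℝ n F D →
    ContDiffOn ℝ n (fun v => ∫ s in (0 : ℝ)..1, F (v, s)) W := by
  induction n with
  | zero =>
    intro G _ _ F hF
    simp only [Nat.cast_zero, contDiffOn_zero] at hF ⊢
    exact continuousOn_parametric_integral (hF.mono hWD)
  | succ n ih =>
    intro G _ _ F hF
    have hF' : ContDiffOn ℝ n (fderiv ℝ F) D := by
      have := (contDiffOn_succ_iff_fderiv_of_isOpen (n := (n : ℕ∞ω)) hD).1 (by exact_mod_cast hF)
      exact this.2.2
    set F₁ : E × ℝ → (E →L[ℝ] G) := fun v => fderiv ℝ F v ∘L .inl ℝ E ℝ with hF₁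
    have hF₁s : ContDiffOn ℝ n F₁ D := hF'.clm_comp contDiffOn_const
    have hd : ∀ v ∈ D, HasFDerivAt (fun x => F (x, v.2)) (F₁ v) v.1 := by
      intro v hv
      have h1 : DifferentiableAt ℝ F v :=
        (hF.contDiffAt (hD.mem_nhds hv)).differentiableAt (by simp)
      exact h1.hasFDerivAt.comp v.1 (hasFDerivAt_prodMk_left v.1 v.2)
    have hint : ∀ {H : Type} [NormedAddCommGroup H] [NormedSpace ℝ H] {K : E × ℝ → H},
        ContinuousOn K D → ∀ x ∈ W, ContinuousOn (fun s => K (x, s)) (Icc 0 1) := by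
      intro H _ _ K hK x hx
      exact hK.comp (by fun_prop) fun s hs => hWD ⟨hx, hs⟩
    have main : ∀ v ∈ W, HasFDerivAt (fun v => ∫ s in (0 : ℝ)..1, F (v, s))
        (∫ s in (0 : ℝ)..1, F₁ (v, s)) v := by
      intro v hv
      obtain ⟨M, hM⟩ : ∃ M, ∀ s ∈ Icc (0 : ℝ) 1, ‖F₁ (v, s)‖ ≤ M :=
        isCompact_Icc.exists_bound_of_continuousOn (hint hF₁s.continuousOn v hv)
      -- The bound `M` holds only over the slice at `v`. With the slack of `1` it holds on an open
      -- set, and the tube lemma for the compact interval gives a neighbourhood of `v` that works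
      -- for all `s`: this is the domination.
      have ho : IsOpen (D ∩ (fun q => ‖F₁ q‖) ⁻¹' Iio (M + 1)) :=
        hF₁s.continuousOn.norm.isOpen_inter_preimage hD isOpen_Iio
      obtain ⟨u, w, hu, -, hvu, hw, huw⟩ := generalized_tube_lemma (isCompact_singleton (x := v))
        (isCompact_Icc (a := (0 : ℝ)) (b := 1)) ho (by
          rintro ⟨x, s⟩ ⟨rfl, hs⟩
          exact ⟨hWD ⟨hv, hs⟩, lt_of_le_of_lt (hM s hs) (by simp)⟩)
      have hus : u ∈ 𝓝 v := hu.mem_nhds (hvu rfl)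
      have hsub : ∀ s ∈ uIoc (0 : ℝ) 1, s ∈ Icc (0 : ℝ) 1 := by
        intro s hs
        rw [uIoc_of_le zero_le_one] at hs
        exact Ioc_subset_Icc_self hs
      have hmeas : ∀ {H : Type} [NormedAddCommGroup H] [NormedSpace ℝ H] {K : E × ℝ → H},
          ContinuousOn K D → ∀ x ∈ W, IntervalIntegrable (fun s => K (x, s))
            MeasureTheory.volume 0 1 := by
        intro H _ _ K hK x hx
        refine ContinuousOn.intervalIntegrable ?_
        rw [uIcc_of_le zero_le_one]
        exact hint hK x hx
      refine intervalIntegral.hasFDerivAt_integral_of_dominated_of_fderiv_le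
        (F := fun x s => F (x, s)) (F' := fun x s => F₁ (x, s)) (bound := fun _ => M + 1)
        hus ?_ (hmeas hF.continuousOn v hv) (intervalIntegrable_iff.1 (hmeas hF₁s.continuousOn v hv)).aestronglyMeasurable
        ?_ intervalIntegrable_const ?_
      · filter_upwards [hW.mem_nhds hv] with x hx
        exact (intervalIntegrable_iff.1 (hmeas hF.continuousOn x hx)).aestronglyMeasurable
      · exact Eventually.of_forall fun s hs x hx => (huw (show (x, s) ∈ u ×ˢ w from ⟨hx, hw (hsub s hs)⟩)).2.le
      · exact Eventually.of_forall fun s hs x hx =>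
          hd (x, s) (huw (show (x, s) ∈ u ×ˢ w from ⟨hx, hw (hsub s hs)⟩)).1
    have : ContDiffOn ℝ (n + 1) (fun v => ∫ s in (0 : ℝ)..1, F (v, s)) W := by
      rw [contDiffOn_succ_iff_fderiv_of_isOpen hW]
      refine ⟨fun v hv => (main v hv).differentiableAt.differentiableWithinAt, by simp, ?_⟩
      exact (ih hF₁s).congr fun v hv => (main v hv).fderiv
    exact_mod_cast this

theorem contDiffOn_parametric_integral {E G : Type} [NormedAddCommGroup E] [NormedSpace ℝ E]
    [NormedAddCommGroup G] [NormedSpace ℝ G]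
    {D : Set (E × ℝ)} (hD : IsOpen D) {W : Set E} (hW : IsOpen W) (hWD : W ×ˢ Icc 0 1 ⊆ D)
    {F : E × ℝ → G} (hF : ContDiffOn ℝ ∞ F D) :
    ContDiffOn ℝ ∞ (fun v => ∫ s in (0 : ℝ)..1, F (v, s)) W :=
  contDiffOn_infty.2 fun n =>
    contDiffOn_parametric_integral_nat hD hW hWD n (hF.of_le (by exact_mod_cast le_top))

end ParametricIntegral

/-! ### Taylor's formula and a parametric Morse lemma -/

/-- Taylor's formula of order two with integral remainder. -/
theorem sub_eq_sq_mul_integral {g g' g'' : ℝ → ℝ} {I : Set ℝ} (hI : Convex ℝ I)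
    (h1 : ∀ t ∈ I, HasDerivAt g (g' t) t) (h2 : ∀ t ∈ I, HasDerivAt g' (g'' t) t)
    (h3 : ContinuousOn g'' I) {x t : ℝ} (hx : x ∈ I) (ht : t ∈ I) (hcrit : g' x = 0) :
    g t - g x = (t - x) ^ 2 * ∫ s in (0 : ℝ)..1, (1 - s) * g'' (x + s * (t - x)) := by
  have hmem : ∀ s ∈ uIcc (0 : ℝ) 1, x + s * (t - x) ∈ I := by
    intro s hs
    rw [uIcc_of_le zero_le_one] at hs
    have := hI.add_smul_sub_mem hx ht hs
    simpa using this
  have hlin : ∀ s : ℝ, HasDerivAt (fun s => x + s * (t - x)) (t - x) s := by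
    intro s
    simpa using ((hasDerivAt_id s).mul_const (t - x)).const_add x
  have hd : ∀ s ∈ uIcc (0 : ℝ) 1, HasDerivAt
      (fun s => (1 - s) * (g' (x + s * (t - x)) * (t - x)) + g (x + s * (t - x)))
      ((t - x) ^ 2 * ((1 - s) * g'' (x + s * (t - x)))) s := by
    intro s hs
    have a1 := (h1 _ (hmem s hs)).comp s (hlin s)
    have a2 := (((h2 _ (hmem s hs)).comp s (hlin s)).mul_const (t - x))
    have a3 := ((hasDerivAt_id s).const_sub 1).mul a2
    refine (a3.add a1).congr_deriv ?_
    simp only [Function.comp, id]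
    ring
  rw [← intervalIntegral.integral_const_mul, intervalIntegral.integral_eq_sub_of_hasDerivAt hd]
  · simp [hcrit]
  · refine ContinuousOn.intervalIntegrable ?_
    refine continuousOn_const.mul ((by fun_prop : ContinuousOn (fun s : ℝ => 1 - s) _).mul ?_)
    exact h3.comp (by fun_prop) hmem

/-- A smooth family of functions with a nondegenerate maximum can be normalized smoothly. -/
theorem exists_morse_coordinate {E : Type} [NormedAddCommGroup E] [NormedSpace ℝ E]
    {U : Set E} (hU : IsOpen U) {δ : ℝ} {f : E × ℝ → ℝ}
    (hf : ContDiffOn ℝ ∞ f (U ×ˢ Ioo (-δ) δ)) {τ : E → ℝ} (hτ : ContDiffOn ℝ ∞ τ U)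
    (hτδ : ∀ e ∈ U, τ e ∈ Ioo (-δ) δ) (hcrit : ∀ e ∈ U, tDeriv f (e, τ e) = 0)
    (hneg : ∀ v ∈ U ×ˢ Ioo (-δ) δ, tDeriv (tDeriv f) v < 0) :
    ∃ ψ : E × ℝ → ℝ, ContDiffOn ℝ ∞ ψ (U ×ˢ Ioo (-δ) δ) ∧
      ∀ e ∈ U, ψ (e, τ e) = 0 ∧ ∀ t ∈ Ioo (-δ) δ,
        ψ (e, t) ^ 2 = f (e, τ e) - f (e, t) ∧ 0 < tDeriv ψ (e, t) := by
  set W := U ×ˢ Ioo (-δ) δ with hWdef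
  have hW : IsOpen W := hU.prod isOpen_Ioo
  have hf1 := contDiffOn_tDeriv hW hf
  have hf2 := contDiffOn_tDeriv hW hf1
  set σ : (E × ℝ) × ℝ → E × ℝ := fun q => (q.1.1, τ q.1.1 + q.2 * (q.1.2 - τ q.1.1)) with hσ
  have hσs : ContDiffOn ℝ ∞ σ ((U ×ˢ univ) ×ˢ univ) := by
    have hτ' : ContDiffOn ℝ ∞ (fun q : (E × ℝ) × ℝ => τ q.1.1) ((U ×ˢ univ) ×ˢ univ) :=
      hτ.comp (contDiff_fst.fst).contDiffOn fun q hq => hq.1.1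
    exact (contDiff_fst.fst).contDiffOn.prodMk
      (hτ'.add (contDiff_snd.contDiffOn.mul ((contDiff_fst.snd).contDiffOn.sub hτ')))
  set D := ((U ×ˢ univ) ×ˢ univ) ∩ σ ⁻¹' W with hDdef
  have hD : IsOpen D :=
    hσs.continuousOn.isOpen_inter_preimage ((hU.prod isOpen_univ).prod isOpen_univ) hW
  have hWD : W ×ˢ Icc 0 1 ⊆ D := by
    rintro ⟨⟨e, t⟩, s⟩ ⟨⟨he, ht⟩, hs⟩
    refine ⟨⟨⟨he, mem_univ _⟩, mem_univ _⟩, he, ?_⟩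
    have := (convex_Ioo (-δ) δ).add_smul_sub_mem (hτδ e he) ht hs
    simpa using this
  -- The Taylor remainder: `f(e, τ) - f(e, t) = (t - τ)² k(e, t)` with `k > 0`, so `(t - τ) √k` is a
  -- smooth square root of the drop.
  set k : E × ℝ → ℝ := fun v => ∫ s in (0 : ℝ)..1,
    (1 - s) * -(tDeriv (tDeriv f) (σ (v, s))) with hk
  have hks : ContDiffOn ℝ ∞ k W := by
    refine contDiffOn_parametric_integral hD hW hWD (F := fun q =>
      (1 - q.2) * -(tDeriv (tDeriv f) (σ q))) ?_
    refine (contDiffOn_const.sub contDiff_snd.contDiffOn).mul ?_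
    exact (hf2.comp (hσs.mono inter_subset_left) fun q hq => hq.2).neg
  have hkpos : ∀ v ∈ W, 0 < k v := by
    intro v hv
    refine intervalIntegral.intervalIntegral_pos_of_pos_on ?_ ?_ zero_lt_one
    · refine ContinuousOn.intervalIntegrable ?_
      rw [uIcc_of_le zero_le_one]
      refine (by fun_prop : ContinuousOn (fun s : ℝ => 1 - s) _).mul ?_
      refine (hf2.continuousOn.comp (hσs.continuousOn.comp (by fun_prop) fun s hs => ?_)
        fun s hs => ?_).neg
      · exact (hWD (show (v, s) ∈ W ×ˢ Icc 0 1 from ⟨hv, hs⟩)).1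
      · exact (hWD (show (v, s) ∈ W ×ˢ Icc 0 1 from ⟨hv, hs⟩)).2
    · intro s hs
      have := hneg _ (hWD (show (v, s) ∈ W ×ˢ Icc 0 1 from ⟨hv, Ioo_subset_Icc_self hs⟩)).2
      exact mul_pos (by linarith [hs.2]) (by linarith)
  have hda : ∀ {g : E × ℝ → ℝ}, ContDiffOn ℝ ∞ g W → ∀ e ∈ U, ∀ t ∈ Ioo (-δ) δ,
      HasDerivAt (fun s => g (e, s)) (tDeriv g (e, t)) t := by
    intro g hg e he t ht
    exact hasDerivAt_tDeriv
      ((hg.contDiffAt (hW.mem_nhds (show (e, t) ∈ W from ⟨he, ht⟩))).differentiableAt (by simp))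
  have hfk : ∀ e ∈ U, ∀ t ∈ Ioo (-δ) δ, f (e, τ e) - f (e, t) = (t - τ e) ^ 2 * k (e, t) := by
    intro e he t ht
    have := sub_eq_sq_mul_integral (convex_Ioo (-δ) δ) (hda hf e he) (hda hf1 e he)
      (hf2.continuousOn.comp (by fun_prop) fun s hs => ⟨he, hs⟩) (hτδ e he) ht (hcrit e he)
    simp only [hk, mul_neg, intervalIntegral.integral_neg, hσ]
    linarith
  have hψs : ContDiffOn ℝ ∞ (fun v : E × ℝ => (v.2 - τ v.1) * √(k v)) W := by
    refine (contDiff_snd.contDiffOn.sub (hτ.comp contDiff_fst.contDiffOn fun v hv => hv.1)).mul ?_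
    exact hks.sqrt fun v hv => (hkpos v hv).ne'
  refine ⟨fun v => (v.2 - τ v.1) * √(k v), hψs, fun e he => ⟨by simp, fun t ht => ⟨?_, ?_⟩⟩⟩
  · rw [hfk e he t ht, mul_pow, Real.sq_sqrt (hkpos (e, t) ⟨he, ht⟩).le]
  · have hsq : ∀ t ∈ Ioo (-δ) δ, 0 < √(k (e, t)) := fun t ht =>
      Real.sqrt_pos.2 (hkpos _ ⟨he, ht⟩)
    set ψ := fun v : E × ℝ => (v.2 - τ v.1) * √(k v) with hψ
    -- At the critical point the derivative of `ψ` is `√k`. Elsewhere `2 ψ ψ' = -f'`, and strict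
    -- concavity gives `f'` the sign opposite to that of `ψ`.
    rcases eq_or_ne t (τ e) with rfl | hne
    · have h1 := hda hψs e he _ ht
      have h2 : HasDerivAt (fun s => √(k (e, s)))
          (tDeriv (fun v => √(k v)) (e, τ e)) (τ e) :=
        hda (hks.sqrt fun v hv => (hkpos v hv).ne') e he _ ht
      have h3 := ((hasDerivAt_id (τ e)).sub_const (τ e)).mul h2
      have h4 := h1.unique h3
      rw [h4]
      simpa using hsq _ ht
    · have h1 := (hda hψs e he _ ht).pow 2
      have h2 := (hda hf e he _ ht).const_sub (f (e, τ e))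
      have h3 : (fun s => ψ (e, s)) ^ 2 =ᶠ[𝓝 t] fun s => f (e, τ e) - f (e, s) := by
        filter_upwards [isOpen_Ioo.mem_nhds ht] with s hs
        simp only [hψ, Pi.pow_apply]
        rw [hfk e he s hs, mul_pow, Real.sq_sqrt (hkpos (e, s) ⟨he, hs⟩).le]
      have h4 := h1.unique (h2.congr_of_eventuallyEq h3)
      have hanti : StrictAntiOn (fun s => tDeriv f (e, s)) (Ioo (-δ) δ) := by
        refine strictAntiOn_of_deriv_neg (convex_Ioo _ _)
          (fun s hs => (hda hf1 e he s hs).continuousAt.continuousWithinAt) fun s hs => ?_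
        rw [interior_Ioo] at hs
        rw [(hda hf1 e he s hs).deriv]
        exact hneg _ ⟨he, hs⟩
      have hp := hsq t ht
      simp only [hψ] at h4
      norm_num at h4
      rcases lt_or_gt_of_ne hne with hlt | hlt
      · have := hanti ht (hτδ e he) hlt
        simp only [hcrit e he] at this
        have h5 : (t - τ e) * √(k (e, t)) < 0 := mul_neg_of_neg_of_pos (by linarith) hp
        nlinarith
      · have := hanti (hτδ e he) ht hlt
        simp only [hcrit e he] at this
        have h5 : 0 < (t - τ e) * √(k (e, t)) := mul_pos (by linarith) hp
        nlinarith

/-! ### Orbits as bounded sequences: a contraction with smooth fixed point -/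

open scoped BoundedContinuousFunction

/-- The recursion looks both backward and forward, so it cannot be iterated directly. Instead, a
bound `C` for all indices from `k` on improves to `C / 2` from `k + 1` on. -/
theorem tendsto_zero_of_contracting {d : ℕ → ℝ} {M A B : ℝ} (hM : ∀ n, |d n| ≤ M) (hA : 0 ≤ A)
    (hB : 0 ≤ B) (hAB : A + B ≤ 3 / 2)
    (hd : ∀ n, 3 * |d (n + 1)| ≤ A * |d n| + B * |d (n + 2)|) : Tendsto d atTop (𝓝 0) := by
  have hM0 : 0 ≤ M := (abs_nonneg _).trans (hM 0)
  have key : ∀ k n, k ≤ n → |d n| ≤ M * (1 / 2) ^ k := by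
    intro k
    induction k with
    | zero => intro n _; simpa using hM n
    | succ k ih =>
      intro n hn
      obtain ⟨m, rfl⟩ : ∃ m, n = m + 1 := ⟨n - 1, by omega⟩
      have h1 := mul_le_mul_of_nonneg_left (ih m (by omega)) hA
      have h2 := mul_le_mul_of_nonneg_left (ih (m + 2) (by omega)) hB
      have h3 := hd m
      have h4 : 0 ≤ M * (1 / 2) ^ k := by positivity
      have h5 := mul_le_mul_of_nonneg_right hAB h4
      rw [pow_succ]
      linarith
  refine squeeze_zero_norm (a := fun n => M * (1 / 2) ^ n) (fun n => key n n le_rfl) ?_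
  have := (tendsto_pow_atTop_nhds_zero_of_lt_one (r := (1 / 2 : ℝ)) (by norm_num)
    (by norm_num)).const_mul M
  simpa using this

/-- The Banach algebra of bounded real sequences. -/
def BddSeq : Type := ℕ →ᵇ ℝ

namespace BddSeq

instance : NormedCommRing BddSeq := inferInstanceAs (NormedCommRing (ℕ →ᵇ ℝ))

instance : NormedAlgebra ℝ BddSeq := inferInstanceAs (NormedAlgebra ℝ (ℕ →ᵇ ℝ))

instance : CompleteSpace BddSeq := inferInstanceAs (CompleteSpace (ℕ →ᵇ ℝ))

instance : FunLike BddSeq ℕ ℝ := inferInstanceAs (FunLike (ℕ →ᵇ ℝ) ℕ ℝ)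

/-- A bounded sequence from its values and a bound. -/
def ofBound (f : ℕ → ℝ) (C : ℝ) (h : ∀ n, ‖f n‖ ≤ C) : BddSeq :=
  BoundedContinuousFunction.ofNormedAddCommGroupDiscrete f C h

variable (s s' : BddSeq) (c : ℝ) (n : ℕ)

@[simp] theorem ofBound_apply (f : ℕ → ℝ) (C : ℝ) (h : ∀ n, ‖f n‖ ≤ C) :
    ofBound f C h n = f n := rfl
@[simp] theorem add_apply : (s + s') n = s n + s' n := rfl
@[simp] theorem sub_apply : (s - s') n = s n - s' n := rfl
@[simp] theorem mul_apply : (s * s') n = s n * s' n := rfl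
@[simp] theorem smul_apply : (c • s) n = c * s n := rfl
@[simp] theorem one_apply : (1 : BddSeq) n = 1 := rfl
@[simp] theorem zero_apply : (0 : BddSeq) n = 0 := rfl

variable {s s'}

@[ext] theorem ext (h : ∀ n, s n = s' n) : s = s' := BoundedContinuousFunction.ext h

variable (s) in
theorem abs_apply_le : |s n| ≤ ‖s‖ := BoundedContinuousFunction.norm_coe_le_norm s n

theorem norm_le {C : ℝ} (hC : 0 ≤ C) : ‖s‖ ≤ C ↔ ∀ n, |s n| ≤ C :=
  BoundedContinuousFunction.norm_le hC

end BddSeq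

/-- The left shift of bounded sequences. -/
def shiftL : BddSeq →L[ℝ] BddSeq :=
  LinearMap.mkContinuous
    { toFun := fun s => BddSeq.ofBound (fun n => s (n + 1)) ‖s‖ fun n => s.abs_apply_le _
      map_add' := fun _ _ => by ext; rfl
      map_smul' := fun _ _ => by ext; rfl }
    1 fun s => by
      rw [one_mul]
      exact (BddSeq.norm_le (norm_nonneg s)).2 fun n => s.abs_apply_le _

/-- The right shift of bounded sequences, filling in a zero. -/
def shiftR : BddSeq →L[ℝ] BddSeq :=
  LinearMap.mkContinuous
    { toFun := fun s => BddSeq.ofBound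
        (fun n => Nat.casesOn n 0 fun m => s m) ‖s‖ fun n => by
          cases n with
          | zero => simp
          | succ n => exact s.abs_apply_le _
      map_add' := fun _ _ => by ext n; cases n <;> simp
      map_smul' := fun _ _ => by ext n; cases n <;> simp }
    1 fun s => by
      rw [one_mul]
      refine (BddSeq.norm_le (norm_nonneg s)).2 fun n => ?_
      cases n with
      | zero => simp
      | succ n => exact s.abs_apply_le _

/-- The sequence `1, 0, 0, …`. -/
def unitSeq : BddSeq :=
  BddSeq.ofBound (fun n => Nat.casesOn n 1 fun _ => 0) 1
    fun n => by cases n <;> simp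

@[simp] theorem shiftL_apply (s : BddSeq) (n : ℕ) : shiftL s n = s (n + 1) := rfl
@[simp] theorem shiftR_zero (s : BddSeq) : shiftR s 0 = 0 := rfl
@[simp] theorem shiftR_succ (s : BddSeq) (n : ℕ) : shiftR s (n + 1) = s n := rfl
@[simp] theorem unitSeq_zero : unitSeq 0 = 1 := rfl
@[simp] theorem unitSeq_succ (n : ℕ) : unitSeq (n + 1) = 0 := rfl

/-- The linear part of `orbitRhs`. -/
def orbitLin (p : ℝ × ℝ × ℝ × ℝ) : BddSeq →L[ℝ] BddSeq := p.1 • shiftL + p.2.1 • shiftR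

/-- For `p = (α, β, a, c)`, the right side of the system `s 0 ^ 2 = α * s 1 - a + c`,
`s (n + 1) ^ 2 = α * s (n + 2) + β * s n - a`. With `α = 1`, `β = b` its solutions are forward
orbits of `phi a b`, with `α = b`, `β = 1` they are backward orbits. -/
def orbitRhs (p : ℝ × ℝ × ℝ × ℝ) (s : BddSeq) : BddSeq :=
  orbitLin p s + (p.2.2.2 • unitSeq - p.2.2.1 • (1 : BddSeq))

theorem orbitRhs_zero (p : ℝ × ℝ × ℝ × ℝ) (s : BddSeq) :
    orbitRhs p s 0 = p.1 * s 1 - p.2.2.1 + p.2.2.2 := by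
  simp [orbitRhs, orbitLin]
  ring

theorem orbitRhs_succ (p : ℝ × ℝ × ℝ × ℝ) (s : BddSeq) (n : ℕ) :
    orbitRhs p s (n + 1) = p.1 * s (n + 2) + p.2.1 * s n - p.2.2.1 := by
  simp [orbitRhs, orbitLin]
  ring

/-- The lower bounds `μ, 3/2, 3/2, …` for solutions of the system. -/
def low (μ : ℝ) (n : ℕ) : ℝ := Nat.casesOn n μ fun _ => 3 / 2

/-- The parameters `p` for which the system is a contraction between the bounds `low μ` and `3`. -/
structure Admissible (μ : ℝ) (p : ℝ × ℝ × ℝ × ℝ) : Prop where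
  pos : 0 < μ
  le : μ ≤ 3 / 2
  fst_le : |p.1| ≤ μ
  add_le : |p.1| + |p.2.1| ≤ 3 / 2
  zero_mem : ∀ u ∈ Icc (3 / 2 : ℝ) 3, p.1 * u - p.2.2.1 + p.2.2.2 ∈ Icc (μ ^ 2) 9
  succ_mem : ∀ u ∈ Icc (3 / 2 : ℝ) 3, ∀ w ∈ Icc μ 3,
    p.1 * u + p.2.1 * w - p.2.2.1 ∈ Icc (9 / 4) 9

/-- Solutions of the system between the bounds `low μ` and `3`. -/
def IsOrbitSeq (μ : ℝ) (p : ℝ × ℝ × ℝ × ℝ) (s : BddSeq) : Prop :=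
  (∀ n, s n ∈ Icc (low μ n) 3) ∧ ∀ n, s n ^ 2 = orbitRhs p s n

namespace Admissible

variable {μ : ℝ} {p : ℝ × ℝ × ℝ × ℝ}

theorem low_pos (h : Admissible μ p) (n : ℕ) : 0 < low μ n := by
  cases n with
  | zero => exact h.pos
  | succ n => norm_num [low]

theorem le_low (h : Admissible μ p) (n : ℕ) : μ ≤ low μ n := by
  cases n with
  | zero => exact le_rfl
  | succ n => exact h.le

theorem low_le (h : Admissible μ p) (n : ℕ) : low μ n ≤ 3 / 2 := by
  cases n with
  | zero => exact h.le
  | succ n => exact le_rfl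

/-- The factor `low μ n` matches the gain `1 / (2 * low μ n)` of the square root at the same index,
whence the contraction factor `1/2` uniformly in `n`. -/
theorem abs_orbitLin_le (h : Admissible μ p) (v : BddSeq) (n : ℕ) :
    |orbitLin p v n| ≤ low μ n * ‖v‖ := by
  have hv : ∀ n, |v n| ≤ ‖v‖ := fun n => v.abs_apply_le n
  cases n with
  | zero =>
    simp only [orbitLin, add_apply, smul_apply, BddSeq.add_apply, BddSeq.smul_apply, shiftL_apply,
      shiftR_zero, mul_zero, add_zero, abs_mul]
    exact mul_le_mul h.fst_le (hv _) (abs_nonneg _) h.pos.le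
  | succ n =>
    simp only [orbitLin, add_apply, smul_apply, BddSeq.add_apply, BddSeq.smul_apply, shiftL_apply,
      shiftR_succ]
    refine (abs_add_le _ _).trans ?_
    rw [abs_mul, abs_mul]
    have h1 := mul_le_mul_of_nonneg_left (hv (n + 1 + 1)) (abs_nonneg p.1)
    have h2 := mul_le_mul_of_nonneg_left (hv n) (abs_nonneg p.2.1)
    have h3 := mul_le_mul_of_nonneg_right h.add_le (norm_nonneg v)
    simp only [low]
    linarith

theorem orbitRhs_mem (h : Admissible μ p) {s : BddSeq} (hs : ∀ n, s n ∈ Icc (low μ n) 3) (n : ℕ) :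
    orbitRhs p s n ∈ Icc (low μ n ^ 2) 9 := by
  cases n with
  | zero =>
    rw [orbitRhs_zero]
    exact h.zero_mem _ (hs 1)
  | succ n =>
    rw [orbitRhs_succ]
    have := h.succ_mem _ (hs (n + 2)) _ ⟨(h.le_low n).trans (hs n).1, (hs n).2⟩
    exact ⟨by norm_num [low]; exact this.1, this.2⟩

end Admissible

theorem orbitRhs_sub (p : ℝ × ℝ × ℝ × ℝ) (s s' : BddSeq) :
    orbitRhs p s - orbitRhs p s' = orbitLin p (s - s') := by
  simp [orbitRhs]

/-- Square roots contract by `1 / (2l)` above `l²`, from `u - v = (x - y)(x + y)`. -/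
theorem abs_sub_le_of_sq {l x y u v : ℝ} (hl : 0 < l) (hx : l ≤ x) (hy : l ≤ y) (hu : x ^ 2 = u)
    (hv : y ^ 2 = v) : |x - y| * (2 * l) ≤ |u - v| := by
  have h1 : u - v = (x - y) * (x + y) := by rw [← hu, ← hv]; ring
  rw [h1, abs_mul, abs_of_nonneg (by linarith : 0 ≤ x + y)]
  exact mul_le_mul_of_nonneg_left (by linarith) (abs_nonneg _)

/-- One step of the contraction: square roots of the right side, truncated to the bounds. -/
def orbitStep (μ : ℝ) (p : ℝ × ℝ × ℝ × ℝ) (s : BddSeq) : BddSeq :=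
  BddSeq.ofBound
    (fun n => √(min 9 (max (low μ n ^ 2) (orbitRhs p s n)))) 3 fun n => by
      rw [Real.norm_of_nonneg (Real.sqrt_nonneg _)]
      refine Real.sqrt_le_iff.2 ⟨by norm_num, (min_le_left _ _).trans (by norm_num)⟩

theorem orbitStep_apply (μ : ℝ) (p : ℝ × ℝ × ℝ × ℝ) (s : BddSeq) (n : ℕ) :
    orbitStep μ p s n = √(min 9 (max (low μ n ^ 2) (orbitRhs p s n))) := rfl

namespace Admissible

variable {μ : ℝ} {p : ℝ × ℝ × ℝ × ℝ}

theorem orbitStep_mem (h : Admissible μ p) (s : BddSeq) (n : ℕ) :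
    orbitStep μ p s n ∈ Icc (low μ n) 3 := by
  rw [orbitStep_apply]
  constructor
  · refine Real.le_sqrt_of_sq_le (le_min ?_ (le_max_left _ _))
    have := h.low_le n
    nlinarith [h.low_pos n]
  · exact Real.sqrt_le_iff.2 ⟨by norm_num, (min_le_left _ _).trans (by norm_num)⟩

theorem orbitStep_sq (_ : Admissible μ p) (s : BddSeq) (n : ℕ) :
    orbitStep μ p s n ^ 2 = min 9 (max (low μ n ^ 2) (orbitRhs p s n)) :=
  Real.sq_sqrt (le_min (by norm_num) ((sq_nonneg _).trans (le_max_left _ _)))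

theorem contractingWith (h : Admissible μ p) : ContractingWith (1 / 2) (orbitStep μ p) := by
  refine ⟨by
    rw [← NNReal.coe_lt_coe]
    norm_num, LipschitzWith.of_dist_le_mul fun s s' => ?_⟩
  rw [dist_eq_norm, dist_eq_norm, BddSeq.norm_le (by positivity)]
  intro n
  have h1 := abs_sub_le_of_sq (h.low_pos n) (h.orbitStep_mem s n).1 (h.orbitStep_mem s' n).1
    (h.orbitStep_sq s n) (h.orbitStep_sq s' n)
  -- Truncation to an interval does not increase distances.
  have h2 : |min 9 (max (low μ n ^ 2) (orbitRhs p s n)) -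
      min 9 (max (low μ n ^ 2) (orbitRhs p s' n))| ≤ |orbitRhs p s n - orbitRhs p s' n| :=
    by
    rw [min_comm 9, min_comm 9, max_comm (low μ n ^ 2), max_comm (low μ n ^ 2)]
    refine (abs_min_sub_min_le_max _ _ _ _).trans ?_
    simpa using abs_max_sub_max_le_abs _ _ _
  have h3 := h.abs_orbitLin_le (s - s') n
  rw [← orbitRhs_sub, BddSeq.sub_apply] at h3
  rw [BddSeq.sub_apply]
  have h4 := h.low_pos n
  have h5 : |orbitStep μ p s n - orbitStep μ p s' n| * 2 ≤ ‖s - s'‖ := by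
    refine le_of_mul_le_mul_left ?_ h4
    linarith
  push_cast
  linarith

theorem exists_isOrbitSeq (h : Admissible μ p) : ∃ s, IsOrbitSeq μ p s := by
  have hfix := h.contractingWith.fixedPoint_isFixedPt
  set s := ContractingWith.fixedPoint (orbitStep μ p) h.contractingWith
  have hs : ∀ n, s n ∈ Icc (low μ n) 3 := fun n => by
    rw [← hfix.eq]
    exact h.orbitStep_mem s n
  refine ⟨s, hs, fun n => ?_⟩
  have h1 := h.orbitStep_sq s n
  rw [hfix.eq] at h1
  -- The truncation serves to make the step a self-map of the whole Banach space. It is inactive at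
  -- the fixed point, because the right side maps the box into the squared bounds.
  rw [h1, max_eq_right (h.orbitRhs_mem hs n).1, min_eq_right (h.orbitRhs_mem hs n).2]

/-- With `p' = p` this is uniqueness; for varying `p` it gives continuity of the solution in the
parameters, and later the Lipschitz bound for `eta`. -/
theorem norm_sub_le (h : Admissible μ p) {p' : ℝ × ℝ × ℝ × ℝ} {s s' : BddSeq}
    (hs : IsOrbitSeq μ p s) (hs' : IsOrbitSeq μ p' s') :
    ‖s - s'‖ ≤ ‖orbitRhs p s' - orbitRhs p' s'‖ / μ := by
  set R := ‖orbitRhs p s' - orbitRhs p' s'‖ with hR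
  have hμ := h.pos
  have key : ‖s - s'‖ ≤ (‖s - s'‖ + R / μ) / 2 := by
    refine (BddSeq.norm_le (by positivity)).2 fun n => ?_
    have h1 := abs_sub_le_of_sq (h.low_pos n) (hs.1 n).1 (hs'.1 n).1 (hs.2 n) (hs'.2 n)
    have h2 := h.abs_orbitLin_le (s - s') n
    rw [← orbitRhs_sub, BddSeq.sub_apply] at h2
    have h3 : |orbitRhs p s' n - orbitRhs p' s' n| ≤ R := by
      have := (orbitRhs p s' - orbitRhs p' s').abs_apply_le n
      rwa [BddSeq.sub_apply] at this
    have h4 := h.low_pos n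
    have h5 : R ≤ low μ n * (R / μ) := by
      rw [mul_div_assoc', le_div_iff₀ hμ, mul_comm]
      exact mul_le_mul_of_nonneg_right (h.le_low n) (norm_nonneg _)
    have h6 := abs_sub_le (orbitRhs p s n) (orbitRhs p s' n) (orbitRhs p' s' n)
    rw [BddSeq.sub_apply]
    have h7 : |s n - s' n| * 2 ≤ ‖s - s'‖ + R / μ := by
      refine le_of_mul_le_mul_left ?_ h4
      linarith
    linarith
  linarith

theorem isOrbitSeq_unique (h : Admissible μ p) {s s' : BddSeq} (hs : IsOrbitSeq μ p s)
    (hs' : IsOrbitSeq μ p s') : s = s' := by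
  have := h.norm_sub_le hs hs'
  simp only [sub_self, norm_zero, zero_div] at this
  exact sub_eq_zero.1 (norm_le_zero_iff.1 this)

end Admissible

open Classical in
/-- The solution of the system (junk for inadmissible parameters). -/
def orbitSeq (μ : ℝ) (p : ℝ × ℝ × ℝ × ℝ) : BddSeq :=
  if h : ∃ s, IsOrbitSeq μ p s then h.choose else 0

namespace Admissible

variable {μ : ℝ} {p : ℝ × ℝ × ℝ × ℝ}

theorem isOrbitSeq_orbitSeq (h : Admissible μ p) : IsOrbitSeq μ p (orbitSeq μ p) := by
  rw [orbitSeq, dif_pos h.exists_isOrbitSeq]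
  exact h.exists_isOrbitSeq.choose_spec

theorem eq_orbitSeq (h : Admissible μ p) {s : BddSeq} (hs : IsOrbitSeq μ p s) :
    orbitSeq μ p = s := h.isOrbitSeq_unique h.isOrbitSeq_orbitSeq hs

end Admissible

theorem contDiff_orbitLin : ContDiff ℝ ∞ orbitLin :=
  (contDiff_fst.smul contDiff_const).add (contDiff_snd.fst.smul contDiff_const)

theorem contDiff_orbitRhs :
    ContDiff ℝ ∞ (fun q : (ℝ × ℝ × ℝ × ℝ) × BddSeq => orbitRhs q.1 q.2) := by
  refine ((contDiff_orbitLin.comp contDiff_fst).clm_apply contDiff_snd).add ?_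
  exact ((contDiff_fst.snd.snd.snd).smul contDiff_const).sub
    ((contDiff_fst.snd.snd.fst).smul contDiff_const)

namespace Admissible

variable {μ : ℝ} {p : ℝ × ℝ × ℝ × ℝ}

/-- The linearized system is invertible. -/
theorem isInvertible (h : Admissible μ p) {s : BddSeq} (hs : ∀ n, low μ n ≤ s n) :
    (ContinuousLinearMap.mul ℝ BddSeq ((2 : ℝ) • s) - orbitLin p).IsInvertible := by
  have hpos : ∀ n, 0 < s n := fun n => (h.low_pos n).trans_le (hs n)
  have hμ := h.pos
  set w : BddSeq := BddSeq.ofBound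
    (fun n => (2 * s n)⁻¹) (2 * μ)⁻¹ (fun n => by
      have := hpos n
      rw [Real.norm_of_nonneg (by positivity)]
      have := (h.le_low n).trans (hs n)
      gcongr) with hw
  have hwn : ∀ n, w n = (2 * s n)⁻¹ := fun n => rfl
  have hsw : ((2 : ℝ) • s) * w = 1 := by
    ext n
    have := (hpos n).ne'
    simp only [BddSeq.mul_apply, BddSeq.smul_apply, hwn, BddSeq.one_apply]
    field_simp
  set A := ContinuousLinearMap.mul ℝ BddSeq ((2 : ℝ) • s)
  set B := ContinuousLinearMap.mul ℝ BddSeq w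
  have hAB : A * B = 1 := by
    ext1 v
    change (2 : ℝ) • s * (w * v) = v
    rw [← mul_assoc, hsw, one_mul]
  have hBA : B * A = 1 := by
    ext1 v
    change w * ((2 : ℝ) • s * v) = v
    rw [← mul_assoc, mul_comm w, hsw, one_mul]
  -- After division by `2 s` the linear part has norm at most `1/2`, so the operator is a unit times
  -- `1 - K` with `‖K‖ < 1`.
  have hK : ‖B * orbitLin p‖ < 1 := by
    refine lt_of_le_of_lt (ContinuousLinearMap.opNorm_le_bound _ (by norm_num : (0 : ℝ) ≤ 1 / 2)
      fun v => ?_) (by norm_num)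
    refine (BddSeq.norm_le (by positivity)).2 fun n => ?_
    change |w n * orbitLin p v n| ≤ _
    have h1 := h.abs_orbitLin_le v n
    have h2 := hpos n
    rw [abs_mul, hwn, abs_of_nonneg (by positivity), inv_mul_le_iff₀
      (by positivity)]
    have h3 := mul_le_mul_of_nonneg_right (hs n) (norm_nonneg v)
    linarith
  have hu : IsUnit (A * (1 - B * orbitLin p)) :=
    (IsUnit.mul ⟨⟨A, B, hAB, hBA⟩, rfl⟩ (isUnit_one_sub_of_norm_lt_one hK))
  have he : A - orbitLin p = A * (1 - B * orbitLin p) := by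
    rw [mul_sub, mul_one, ← mul_assoc, hAB, one_mul]
  rw [he]
  obtain ⟨u, hu⟩ := hu
  exact ⟨ContinuousLinearEquiv.unitsEquiv ℝ BddSeq u, by rw [← hu]; rfl⟩

end Admissible

/-- The solution of the system depends smoothly on the parameters. -/
theorem contDiffAt_orbitSeq {μ : ℝ} {p : ℝ × ℝ × ℝ × ℝ} (h : ∀ᶠ q in 𝓝 p, Admissible μ q) :
    ContDiffAt ℝ ∞ (orbitSeq μ) p := by
  have hp := h.self_of_nhds
  have hsol := hp.isOrbitSeq_orbitSeq
  set f : (ℝ × ℝ × ℝ × ℝ) × BddSeq → BddSeq := fun q => q.2 * q.2 - orbitRhs q.1 q.2 with hf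
  have hfs : ContDiff ℝ ∞ f := (contDiff_snd.mul contDiff_snd).sub contDiff_orbitRhs
  have hzero : ∀ {q}, Admissible μ q → f (q, orbitSeq μ q) = 0 := by
    intro q hq
    ext n
    have := hq.isOrbitSeq_orbitSeq.2 n
    simp only [hf, BddSeq.sub_apply, BddSeq.mul_apply,
      BddSeq.zero_apply]
    linarith
  refine contDiffAt_of_implicit (f := f) (by simp) hfs.contDiffAt ?_ ?_ ?_
  · have h1 : HasFDerivAt (fun s => f (p, s))
        (fderiv ℝ f (p, orbitSeq μ p) ∘L .inr ℝ (ℝ × ℝ × ℝ × ℝ) BddSeq) (orbitSeq μ p) :=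
      ((hfs.differentiable (by simp)) (p, orbitSeq μ p)).hasFDerivAt.comp (orbitSeq μ p)
        (hasFDerivAt_prodMk_right p (orbitSeq μ p))
    have h2 : HasFDerivAt (fun s => f (p, s))
        (ContinuousLinearMap.mul ℝ BddSeq ((2 : ℝ) • orbitSeq μ p) - orbitLin p)
        (orbitSeq μ p) := by
      have h3 := ((hasFDerivAt_id (𝕜 := ℝ) (orbitSeq μ p)).mul (hasFDerivAt_id (orbitSeq μ p))).sub
        ((orbitLin p).hasFDerivAt.add_const (p.2.2.2 • unitSeq - p.2.2.1 • (1 : BddSeq)))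
      refine h3.congr_fderiv ?_
      ext1 v
      simp [two_smul]
    rw [h1.unique h2]
    exact hp.isInvertible fun n => (hsol.1 n).1
  -- Continuity of the solution, which `contDiffAt_of_implicit` upgrades to smoothness, comes from
  -- `norm_sub_le`.
  · rw [ContinuousAt, tendsto_iff_norm_sub_tendsto_zero]
    have h1 : Tendsto (fun q => ‖orbitRhs q (orbitSeq μ p) - orbitRhs p (orbitSeq μ p)‖ / μ) (𝓝 p)
        (𝓝 0) := by
      have h2 : Continuous fun q : ℝ × ℝ × ℝ × ℝ =>
          ‖orbitRhs q (orbitSeq μ p) - orbitRhs p (orbitSeq μ p)‖ / μ :=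
        (((contDiff_orbitRhs.continuous.comp (continuous_id.prodMk continuous_const)).sub
          continuous_const).norm).div_const _
      simpa using h2.tendsto p
    refine squeeze_zero' (Eventually.of_forall fun _ => norm_nonneg _) ?_ h1
    filter_upwards [h] with q hq
    exact hq.norm_sub_le hq.isOrbitSeq_orbitSeq hsol
  · filter_upwards [h] with q hq
    rw [hzero hq, hzero hp]

theorem Admissible.tendsto_orbitSeq {μ : ℝ} {p : ℝ × ℝ × ℝ × ℝ} (h : Admissible μ p) {y : ℝ}
    (hy : 3 / 2 ≤ y) (hfix : y ^ 2 = p.1 * y + p.2.1 * y - p.2.2.1) :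
    Tendsto (orbitSeq μ p) atTop (𝓝 y) := by
  have hsol := h.isOrbitSeq_orbitSeq
  set s := orbitSeq μ p
  have h0 : Tendsto (fun n => s n - y) atTop (𝓝 0) := by
    refine tendsto_zero_of_contracting (M := ‖s‖ + |y|) (A := |p.2.1|) (B := |p.1|)
      (fun n => ?_) (abs_nonneg _) (abs_nonneg _) (by linarith [h.add_le]) fun n => ?_
    · exact (abs_sub _ _).trans (add_le_add_left (s.abs_apply_le n) _)
    · have h1 := hsol.2 (n + 1)
      rw [orbitRhs_succ] at h1
      -- The difference of the system and the fixed point equation; the factor `s (n + 1) + y` is at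
      -- least `3`.
      have h2 : (s (n + 1) - y) * (s (n + 1) + y) =
          p.2.1 * (s n - y) + p.1 * (s (n + 2) - y) := by linarith
      have h3 : (3 / 2 : ℝ) ≤ s (n + 1) := (hsol.1 (n + 1)).1
      have h4 : |s (n + 1) - y| * (s (n + 1) + y) =
          |p.2.1 * (s n - y) + p.1 * (s (n + 2) - y)| := by
        rw [← h2, abs_mul, abs_of_nonneg (by linarith : 0 ≤ s (n + 1) + y)]
      have h5 := abs_add_le (p.2.1 * (s n - y)) (p.1 * (s (n + 2) - y))
      rw [abs_mul, abs_mul] at h5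
      have h6 := mul_le_mul_of_nonneg_left (by linarith : 3 ≤ s (n + 1) + y)
        (abs_nonneg (s (n + 1) - y))
      linarith
  simpa using h0.add_const y

/-- The constant sequence solves the system when `c = β y`, so uniqueness applies. -/
theorem Admissible.orbitSeq_eq_const {μ : ℝ} {p : ℝ × ℝ × ℝ × ℝ} (h : Admissible μ p) {y : ℝ}
    (hy : y ∈ Icc (3 / 2 : ℝ) 3) (hfix : y ^ 2 = p.1 * y + p.2.1 * y - p.2.2.1)
    (hc : p.2.2.2 = p.2.1 * y) (n : ℕ) : orbitSeq μ p n = y := by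
  rw [h.eq_orbitSeq (s := BddSeq.ofBound (fun _ => y) |y| fun _ => le_rfl) ⟨fun n => ?_, fun n => ?_⟩]
  · rfl
  · exact ⟨(h.low_le n).trans hy.1, hy.2⟩
  · cases n with
    | zero =>
      rw [orbitRhs_zero]
      simp only [BddSeq.ofBound_apply]
      linarith
    | succ n =>
      rw [orbitRhs_succ]
      simp only [BddSeq.ofBound_apply]
      linarith

/-! ### The fixed point -/

theorem mem_params {r : ℝ} {q : ℝ × ℝ} : q ∈ params r ↔ |q.1 + 2| < r ∧ |q.2| < r := by
  simp only [params, mem_prod, mem_Ioo, abs_lt]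
  constructor
  · rintro ⟨⟨h1, h2⟩, h3, h4⟩
    exact ⟨⟨by linarith, by linarith⟩, h3, h4⟩
  · rintro ⟨⟨h1, h2⟩, h3, h4⟩
    exact ⟨⟨by linarith, by linarith⟩, h3, h4⟩

theorem params_eq_ball (r : ℝ) : params r = Metric.ball ((-2 : ℝ), (0 : ℝ)) r := by
  rw [← ball_prod_same, Real.ball_eq_Ioo, Real.ball_eq_Ioo, params, zero_sub, zero_add]

theorem isOpen_params (r : ℝ) : IsOpen (params r) := isOpen_Ioo.prod isOpen_Ioo

theorem params_mono {r r' : ℝ} (h : r ≤ r') : params r ⊆ params r' := by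
  rw [params_eq_ball, params_eq_ball]
  exact Metric.ball_subset_ball h

section FixedPoint

variable {a b : ℝ}

theorem disc_bounds (h : (a, b) ∈ params (1 / 50)) :
    8 < (1 + b) ^ 2 - 4 * a ∧ (1 + b) ^ 2 - 4 * a < 10 := by
  rw [mem_params] at h
  obtain ⟨h1, h2⟩ := abs_lt.1 h.1
  obtain ⟨h3, h4⟩ := abs_lt.1 h.2
  simp only at h1 h2 h3 h4
  constructor <;> nlinarith

theorem yFix_mem (h : (a, b) ∈ params (1 / 50)) : yFix a b ∈ Ioo (19 / 10 : ℝ) (21 / 10) := by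
  have h' := h
  rw [mem_params] at h
  obtain ⟨h1, h2⟩ := abs_lt.1 h.1
  obtain ⟨h3, h4⟩ := abs_lt.1 h.2
  simp only at h1 h2 h3 h4
  have h5 : 29 / 10 < √((1 + b) ^ 2 - 4 * a) := Real.lt_sqrt_of_sq_lt (by nlinarith)
  have h6 : √((1 + b) ^ 2 - 4 * a) < 31 / 10 := by
    rw [Real.sqrt_lt' (by norm_num)]
    nlinarith
  constructor <;> (rw [yFix]; linarith)

theorem yFix_sq (h : (a, b) ∈ params (1 / 50)) :
    yFix a b ^ 2 = (1 + b) * yFix a b - a := by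
  have h1 := Real.sq_sqrt (show 0 ≤ (1 + b) ^ 2 - 4 * a by linarith [(disc_bounds h).1])
  rw [yFix]
  nlinarith

theorem phi_pFix (h : (a, b) ∈ params (1 / 50)) : phi a b (pFix a b) = pFix a b := by
  have := yFix_sq h
  refine Prod.ext rfl ?_
  simp only [phi, pFix]
  linarith

theorem contDiff_phi (a b : ℝ) : ContDiff ℝ ∞ (phi a b) := by
  unfold phi
  fun_prop

theorem fderiv_phi (a b : ℝ) (z v : ℝ × ℝ) :
    fderiv ℝ (phi a b) z v = (v.2, -b * v.1 + 2 * z.2 * v.2) := by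
  have h1 : HasFDerivAt (fun w : ℝ × ℝ => w.2) (ContinuousLinearMap.snd ℝ ℝ ℝ) z := hasFDerivAt_snd
  have h2 : HasFDerivAt (fun w : ℝ × ℝ => w.1) (ContinuousLinearMap.fst ℝ ℝ ℝ) z := hasFDerivAt_fst
  have h3 := h1.prodMk (((h2.const_mul b).const_sub a).add (h1.pow 2))
  have h4 : HasFDerivAt (phi a b) _ z := h3
  rw [h4.fderiv]
  simp

theorem isDissipativeSaddle (h : (a, b) ∈ params (1 / 50)) (hb : b ≠ 0) :
    IsDissipativeSaddle (phi a b) (pFix a b) := by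
  obtain ⟨hy1, hy2⟩ := yFix_mem h
  rw [mem_params] at h
  have hb' : |b| < 1 / 50 := h.2
  obtain ⟨h3, h4⟩ := abs_lt.1 hb'
  set y := yFix a b with hy
  have hs := Real.sq_sqrt (show 0 ≤ y ^ 2 - b by nlinarith)
  have hs1 : 1 < √(y ^ 2 - b) := Real.lt_sqrt_of_sq_lt (by nlinarith)
  set t := √(y ^ 2 - b)
  have ev : ∀ l : ℝ, l ^ 2 = 2 * y * l - b →
      Module.End.HasEigenvalue (fderiv ℝ (phi a b) (pFix a b) : (ℝ × ℝ) →ₗ[ℝ] (ℝ × ℝ)) l := by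
    intro l hl
    refine Module.End.hasEigenvalue_of_hasEigenvector (x := ((1 : ℝ), l))
      (Module.End.hasEigenvector_iff.2 ⟨Module.End.mem_eigenspace_iff.2 ?_, by simp⟩)
    change fderiv ℝ (phi a b) (pFix a b) (1, l) = _
    rw [fderiv_phi]
    refine Prod.ext (by simp) ?_
    simp only [pFix, Prod.smul_snd, smul_eq_mul, ← hy]
    linarith
  -- The eigenvalues are `y ± √(y² - b)` and their product is `b`. As `y + t > 2`, both `|lam| < 1`
  -- and dissipativity follow from `|b| < 1/50`.
  have hprod : |y - t| * (y + t) = |b| := by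
    have h5 : b = (y - t) * (y + t) := by linarith
    rw [h5, abs_mul, abs_of_pos (show 0 < y + t by linarith)]
  have hbpos := abs_pos.2 hb
  refine ⟨phi_pFix (mem_params.2 h), (contDiff_phi a b).differentiable (by simp) _, y - t, y + t,
    ev _ (by nlinarith), ev _ (by nlinarith), ?_, ?_, by linarith, by linarith⟩
  · rw [abs_pos]
    intro h0
    rw [h0, abs_zero, zero_mul] at hprod
    exact hb (abs_eq_zero.1 hprod.symm)
  · by_contra! hc
    nlinarith

end FixedPoint

/-! ### Invariance of the stable and unstable sets -/

theorem phi_mem_Wu {a b : ℝ} {z : ℝ × ℝ} (h : z ∈ Wu a b) : phi a b z ∈ Wu a b := by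
  obtain ⟨w, h0, h1, h2⟩ := h
  refine ⟨fun n => Nat.casesOn n (phi a b z) w, rfl, fun n => ?_, ?_⟩
  · cases n with
    | zero => simp [h0]
    | succ n => exact h1 n
  · exact (tendsto_add_atTop_iff_nat 1).1 h2

/-! ### Admissible parameters -/

theorem abs_mul_le_of_mem {x u d : ℝ} (hx : |x| < d) (hu : |u| ≤ 3) : |x * u| ≤ 3 * d := by
  rw [abs_mul]
  nlinarith [abs_nonneg x, abs_nonneg u]

/-- The entry `p.1` is always `1` in the application. It is allowed to vary so that the hypotheses
are open in all four parameters, as `contDiffAt_orbitSeq` requires; likewise `p.2.1` in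
`admissible_unstable`. -/
theorem admissible_stable {p : ℝ × ℝ × ℝ × ℝ} (h1 : |p.1 - 1| < 1 / 50) (h2 : |p.2.1| < 1 / 50)
    (h3 : |p.2.2.1 + 2| < 1 / 50) (h4 : |p.2.2.2| < 1 / 10) : Admissible (3 / 2) p := by
  obtain ⟨α, β, a, c⟩ := p
  simp only at h1 h2 h3 h4
  have b1 := abs_lt.1 h1
  have b3 := abs_lt.1 h3
  have b4 := abs_lt.1 h4
  have hα : |α| ≤ 51 / 50 := abs_le.2 ⟨by linarith [b1.1], by linarith [b1.2]⟩
  refine ⟨by norm_num, le_rfl, hα.trans (by norm_num), by simp only; linarith, ?_, ?_⟩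
  · intro u hu
    have e1 := abs_le.1 (abs_mul_le_of_mem h1 (abs_le.2 ⟨by linarith [hu.1], hu.2⟩))
    simp only
    constructor <;> nlinarith [hu.1, hu.2, e1.1, e1.2, b3.1, b3.2, b4.1, b4.2]
  · intro u hu w hw
    have e1 := abs_le.1 (abs_mul_le_of_mem h1 (abs_le.2 ⟨by linarith [hu.1], hu.2⟩))
    have e2 := abs_le.1 (abs_mul_le_of_mem h2 (abs_le.2 ⟨by linarith [hw.1], hw.2⟩))
    simp only
    constructor <;> nlinarith [hu.1, hu.2, e1.1, e1.2, b3.1, b3.2, e2.1, e2.2]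

/-- The bound `-176/100` is fitted to `μ = 2/5`: `s 0 ^ 2` is at least `-3/50 + (2 - 1/50) - 176/100
= (2/5)²`. It leaves room for the required abscissas down to `-7/4`. -/
theorem admissible_unstable {p : ℝ × ℝ × ℝ × ℝ} (h1 : |p.1| < 1 / 50) (h2 : |p.2.1 - 1| < 1 / 50)
    (h3 : |p.2.2.1 + 2| < 1 / 50) (h4 : p.2.2.2 ∈ Ioo (-(176 / 100) : ℝ) (29 / 10)) :
    Admissible (2 / 5) p := by
  obtain ⟨α, β, a, c⟩ := p
  simp only at h1 h2 h3 h4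
  have b2 := abs_lt.1 h2
  have b3 := abs_lt.1 h3
  have hβ : |β| ≤ 51 / 50 := abs_le.2 ⟨by linarith [b2.1], by linarith [b2.2]⟩
  refine ⟨by norm_num, by norm_num, by simp only; linarith, by simp only; linarith, ?_, ?_⟩
  · intro u hu
    have e1 := abs_le.1 (abs_mul_le_of_mem h1 (abs_le.2 ⟨by linarith [hu.1], hu.2⟩))
    simp only
    constructor <;> nlinarith [hu.1, hu.2, e1.1, e1.2, b3.1, b3.2, h4.1, h4.2]
  · intro u hu w hw
    have e1 := abs_le.1 (abs_mul_le_of_mem h1 (abs_le.2 ⟨by linarith [hu.1], hu.2⟩))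
    have e2 : (β - 1) * w ≤ 1 / 50 * w := mul_le_mul_of_nonneg_right b2.2.le (by linarith [hw.1])
    have e3 : -(1 / 50) * w ≤ (β - 1) * w := mul_le_mul_of_nonneg_right b2.1.le (by linarith [hw.1])
    simp only
    constructor <;> nlinarith [hu.1, hu.2, e1.1, e1.2, b3.1, b3.2, hw.1, hw.2]

/-! ### The stable graph -/

/-- The domain of `eta`. -/
def stableDom : Set ((ℝ × ℝ) × ℝ) := params (1 / 50) ×ˢ Ioo (-3) 3

/-- The domain of `pre` and `xi`. -/
def unstableDom : Set ((ℝ × ℝ) × ℝ) := params (1 / 50) ×ˢ Ioo (-(176 / 100)) (29 / 10)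

theorem isOpen_stableDom : IsOpen stableDom := (isOpen_params _).prod isOpen_Ioo

theorem isOpen_unstableDom : IsOpen unstableDom := (isOpen_params _).prod isOpen_Ioo

/-- The parameters of `orbitSeq` for the forward orbit starting with the abscissa `v.2`. -/
def stableParam (v : (ℝ × ℝ) × ℝ) : ℝ × ℝ × ℝ × ℝ := (1, v.1.2, v.1.1, v.1.2 * v.2)

/-- The parameters of `orbitSeq` for the backward orbit ending at the abscissa `v.2`. -/
def unstableParam (v : (ℝ × ℝ) × ℝ) : ℝ × ℝ × ℝ × ℝ := (v.1.2, 1, v.1.1, v.2)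

/-- The stable graph `η`. -/
def eta (v : (ℝ × ℝ) × ℝ) : ℝ := orbitSeq (3 / 2) (stableParam v) 0

/-- The abscissa of the preimage of the point of the unstable graph with abscissa `v.2`. -/
def pre (v : (ℝ × ℝ) × ℝ) : ℝ := orbitSeq (2 / 5) (unstableParam v) 0

/-- The unstable graph `ξ`. -/
def xi (v : (ℝ × ℝ) × ℝ) : ℝ := v.1.1 - v.1.2 * pre v + v.2 ^ 2

theorem stableParam_bounds {v : (ℝ × ℝ) × ℝ} (hv : v ∈ stableDom) :
    |(stableParam v).1 - 1| < 1 / 50 ∧ |(stableParam v).2.1| < 1 / 50 ∧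
    |(stableParam v).2.2.1 + 2| < 1 / 50 ∧ |(stableParam v).2.2.2| < 1 / 10 := by
  have h1 := mem_params.1 hv.1
  have h2 : |v.2| ≤ 3 := abs_le.2 ⟨hv.2.1.le, hv.2.2.le⟩
  refine ⟨by simp [stableParam], h1.2, h1.1, ?_⟩
  exact (abs_mul_le_of_mem h1.2 h2).trans_lt (by norm_num)

theorem unstableParam_bounds {v : (ℝ × ℝ) × ℝ} (hv : v ∈ unstableDom) :
    |(unstableParam v).1| < 1 / 50 ∧ |(unstableParam v).2.1 - 1| < 1 / 50 ∧
    |(unstableParam v).2.2.1 + 2| < 1 / 50 ∧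
    (unstableParam v).2.2.2 ∈ Ioo (-(176 / 100) : ℝ) (29 / 10) := by
  have h1 := mem_params.1 hv.1
  exact ⟨h1.2, by simp [unstableParam], h1.1, hv.2⟩

theorem admissible_stableParam {v : (ℝ × ℝ) × ℝ} (hv : v ∈ stableDom) :
    Admissible (3 / 2) (stableParam v) := by
  obtain ⟨h1, h2, h3, h4⟩ := stableParam_bounds hv
  exact admissible_stable h1 h2 h3 h4

theorem admissible_unstableParam {v : (ℝ × ℝ) × ℝ} (hv : v ∈ unstableDom) :
    Admissible (2 / 5) (unstableParam v) := by
  obtain ⟨h1, h2, h3, h4⟩ := unstableParam_bounds hv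
  exact admissible_unstable h1 h2 h3 h4

theorem contDiff_orbit_apply (n : ℕ) : ContDiff ℝ ∞ (fun s : BddSeq => s n) :=
  (LinearMap.mkContinuous
    { toFun := fun s : BddSeq => s n
      map_add' := fun _ _ => rfl
      map_smul' := fun _ _ => rfl } 1 fun s => by
      rw [one_mul]
      exact s.abs_apply_le n : BddSeq →L[ℝ] ℝ).contDiff

theorem eventually_abs_lt {f : ℝ × ℝ × ℝ × ℝ → ℝ} (hf : Continuous f) {p : ℝ × ℝ × ℝ × ℝ} {d : ℝ}
    (h : |f p| < d) : ∀ᶠ q in 𝓝 p, |f q| < d :=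
  hf.abs.continuousAt.eventually_lt continuousAt_const h

theorem contDiffOn_eta : ContDiffOn ℝ ∞ eta stableDom := by
  intro v hv
  obtain ⟨h1, h2, h3, h4⟩ := stableParam_bounds hv
  have h : ∀ᶠ q in 𝓝 (stableParam v), Admissible (3 / 2) q := by
    filter_upwards [eventually_abs_lt (f := fun q => q.1 - 1) (by fun_prop) h1,
      eventually_abs_lt (f := fun q => q.2.1) (by fun_prop) h2,
      eventually_abs_lt (f := fun q => q.2.2.1 + 2) (by fun_prop) h3,
      eventually_abs_lt (f := fun q => q.2.2.2) (by fun_prop) h4] with q k1 k2 k3 k4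
    exact admissible_stable k1 k2 k3 k4
  have hs : ContDiff ℝ ∞ stableParam := by
    unfold stableParam
    fun_prop
  exact ((contDiff_orbit_apply 0).contDiffAt.comp v
    ((contDiffAt_orbitSeq h).comp v hs.contDiffAt)).contDiffWithinAt

theorem contDiffOn_pre : ContDiffOn ℝ ∞ pre unstableDom := by
  intro v hv
  obtain ⟨h1, h2, h3, h4⟩ := unstableParam_bounds hv
  have h : ∀ᶠ q in 𝓝 (unstableParam v), Admissible (2 / 5) q := by
    have hc : ContinuousAt (fun q : ℝ × ℝ × ℝ × ℝ => q.2.2.2) (unstableParam v) := by fun_prop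
    filter_upwards [eventually_abs_lt (f := fun q => q.1) (by fun_prop) h1,
      eventually_abs_lt (f := fun q => q.2.1 - 1) (by fun_prop) h2,
      eventually_abs_lt (f := fun q => q.2.2.1 + 2) (by fun_prop) h3,
      hc.eventually (isOpen_Ioo.mem_nhds h4)] with q k1 k2 k3 k4
    exact admissible_unstable k1 k2 k3 k4
  have hs : ContDiff ℝ ∞ unstableParam := by
    unfold unstableParam
    fun_prop
  exact ((contDiff_orbit_apply 0).contDiffAt.comp v
    ((contDiffAt_orbitSeq h).comp v hs.contDiffAt)).contDiffWithinAt

theorem contDiffOn_xi : ContDiffOn ℝ ∞ xi unstableDom := by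
  have h1 : ContDiff ℝ ∞ (fun v : (ℝ × ℝ) × ℝ => v.1.1) := by fun_prop
  have h2 : ContDiff ℝ ∞ (fun v : (ℝ × ℝ) × ℝ => v.1.2) := by fun_prop
  have h3 : ContDiff ℝ ∞ (fun v : (ℝ × ℝ) × ℝ => v.2 ^ 2) := by fun_prop
  exact (h1.contDiffOn.sub (h2.contDiffOn.mul contDiffOn_pre)).add h3.contDiffOn

theorem eta_mem_Ws {v : (ℝ × ℝ) × ℝ} (hv : v ∈ stableDom) : (v.2, eta v) ∈ Ws v.1.1 v.1.2 := by
  obtain ⟨⟨a, b⟩, x⟩ := v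
  have hA := admissible_stableParam hv
  have hy := yFix_mem hv.1
  have hlim := hA.tendsto_orbitSeq (y := yFix a b) (by linarith [hy.1])
    (by simp only [stableParam]; linarith [yFix_sq hv.1])
  have hsol := hA.isOrbitSeq_orbitSeq
  set s := orbitSeq (3 / 2) (stableParam ((a, b), x)) with hs
  have hz : eta ((a, b), x) = s 0 := rfl
  -- The orbit of `(x, s 0)` runs through pairs of consecutive terms; the abscissa `x` enters only
  -- the equation of index `0`, through `c = b x`.
  have horb : ∀ n, (phi a b)^[n + 1] (x, s 0) = (s n, s (n + 1)) := by
    intro n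
    induction n with
    | zero =>
      have := hsol.2 0
      rw [orbitRhs_zero] at this
      simp only [stableParam] at this
      refine Prod.ext rfl ?_
      simp only [zero_add, Function.iterate_one, phi]
      linarith
    | succ n ih =>
      have := hsol.2 (n + 1)
      rw [orbitRhs_succ] at this
      simp only [stableParam] at this
      rw [Function.iterate_succ_apply', ih]
      refine Prod.ext rfl ?_
      simp only [phi]
      linarith
  simp only [Ws, stableSet, mem_ofPred_eq, hz]
  rw [← tendsto_add_atTop_iff_nat 1]
  simp only [horb]
  exact hlim.prodMk_nhds ((tendsto_add_atTop_iff_nat 1).2 hlim)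

/-- The backward orbit of the point of the unstable graph with abscissa `v.2`. -/
theorem xi_mem_Wu {v : (ℝ × ℝ) × ℝ} (hv : v ∈ unstableDom) :
    (pre v, v.2) ∈ Wu v.1.1 v.1.2 ∧ (v.2, xi v) ∈ Wu v.1.1 v.1.2 := by
  obtain ⟨⟨a, b⟩, x⟩ := v
  have hA := admissible_unstableParam hv
  have hy := yFix_mem hv.1
  have hlim := hA.tendsto_orbitSeq (y := yFix a b) (by linarith [hy.1])
    (by simp only [unstableParam]; linarith [yFix_sq hv.1])
  have hsol := hA.isOrbitSeq_orbitSeq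
  set s := orbitSeq (2 / 5) (unstableParam ((a, b), x)) with hs
  have hz : pre ((a, b), x) = s 0 := rfl
  have h1 : (pre ((a, b), x), x) ∈ Wu a b := by
    -- The backward orbit is `(s 0, x), (s 1, s 0), (s 2, s 1), …`: preimages prepend a new
    -- abscissa.
    refine ⟨fun n => Nat.casesOn n (s 0, x) fun m => (s (m + 1), s m), rfl,
      fun n => ?_, ?_⟩
    · cases n with
      | zero =>
        have := hsol.2 0
        rw [orbitRhs_zero] at this
        simp only [unstableParam] at this
        refine Prod.ext rfl ?_
        change a - b * s 1 + s 0 ^ 2 = x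
        linarith
      | succ n =>
        have := hsol.2 (n + 1)
        rw [orbitRhs_succ] at this
        simp only [unstableParam] at this
        refine Prod.ext rfl ?_
        change a - b * s (n + 2) + s (n + 1) ^ 2 = s n
        linarith
    · rw [← tendsto_add_atTop_iff_nat 1]
      exact ((tendsto_add_atTop_iff_nat 1).2 hlim).prodMk_nhds hlim
  exact ⟨h1, phi_mem_Wu h1⟩

theorem pre_pos {v : (ℝ × ℝ) × ℝ} (hv : v ∈ unstableDom) : 0 < pre v := by
  have h := ((admissible_unstableParam hv).isOrbitSeq_orbitSeq.1 0).1
  exact lt_of_lt_of_le (by norm_num [low]) h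

/-- The hypothesis covers two cases at once: `b = 0`, where the stable graph is horizontal, and the
abscissa of the fixed point. -/
theorem eta_eq_yFix {v : (ℝ × ℝ) × ℝ} (hv : v ∈ stableDom)
    (h : v.1.2 * v.2 = v.1.2 * yFix v.1.1 v.1.2) : eta v = yFix v.1.1 v.1.2 := by
  have hy := yFix_mem hv.1
  exact (admissible_stableParam hv).orbitSeq_eq_const ⟨by linarith [hy.1], by linarith [hy.2]⟩
    (by simp only [stableParam]; linarith [yFix_sq hv.1]) h 0

theorem xi_yFix {q : ℝ × ℝ} (hq : q ∈ params (1 / 50)) :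
    xi (q, yFix q.1 q.2) = yFix q.1 q.2 := by
  have hy := yFix_mem hq
  have hv : (q, yFix q.1 q.2) ∈ unstableDom := ⟨hq, by linarith [hy.1], by linarith [hy.2]⟩
  have h := (admissible_unstableParam hv).orbitSeq_eq_const (y := yFix q.1 q.2)
    ⟨by linarith [hy.1], by linarith [hy.2]⟩
    (by simp only [unstableParam]; linarith [yFix_sq hq]) (by simp [unstableParam]) 0
  have h' : pre (q, yFix q.1 q.2) = yFix q.1 q.2 := h
  simp only [xi, h']
  linarith [yFix_sq hq]

/-- The two parameters differ only in `c`, by `b (x - x')`, so `norm_sub_le` gives the Lipschitz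
constant `|b| / (3/2)`, well below `1`. -/
theorem abs_eta_sub_le {q : ℝ × ℝ} (hq : q ∈ params (1 / 50)) {x x' : ℝ} (hx : x ∈ Ioo (-3 : ℝ) 3)
    (hx' : x' ∈ Ioo (-3 : ℝ) 3) : |eta (q, x) - eta (q, x')| ≤ |x - x'| := by
  have hA := admissible_stableParam (v := (q, x)) ⟨hq, hx⟩
  have hA' := admissible_stableParam (v := (q, x')) ⟨hq, hx'⟩
  have h := hA.norm_sub_le hA.isOrbitSeq_orbitSeq hA'.isOrbitSeq_orbitSeq
  have h0 := (orbitSeq (3 / 2) (stableParam (q, x)) -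
    orbitSeq (3 / 2) (stableParam (q, x'))).abs_apply_le 0
  have hb : |q.2| < 1 / 50 := (mem_params.1 hq).2
  refine (h0.trans h).trans ?_
  rw [div_le_iff₀ (by norm_num), BddSeq.norm_le (by positivity)]
  intro n
  rw [BddSeq.sub_apply]
  cases n with
  | zero =>
    rw [orbitRhs_zero, orbitRhs_zero]
    simp only [stableParam]
    have : ∀ y : ℝ, 1 * y - q.1 + q.2 * x - (1 * y - q.1 + q.2 * x') = q.2 * (x - x') :=
      fun y => by ring
    rw [this, abs_mul]
    nlinarith [abs_nonneg (x - x')]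
  | succ n =>
    rw [orbitRhs_succ, orbitRhs_succ]
    simp only [stableParam, sub_self, abs_zero]
    positivity

theorem isStableGraph {r : ℝ} (hr : r ≤ 1 / 50) :
    IsStableGraph r (fun a b x => eta ((a, b), x)) := by
  refine ⟨contDiffOn_eta.mono (prod_mono (params_mono hr) fun x hx => ?_), fun a b hab => ?_⟩
  · exact ⟨by linarith [hx.1], by linarith [hx.2]⟩
  · have hq := params_mono hr hab
    have hy := yFix_mem hq
    refine ⟨fun x hx => eta_mem_Ws (v := ((a, b), x)) ⟨hq, by linarith [hx.1], by linarith [hx.2]⟩,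
      ⟨by linarith [hy.1], by linarith [hy.2]⟩, ?_⟩
    exact eta_eq_yFix (v := ((a, b), yFix a b)) ⟨hq, by linarith [hy.1], by linarith [hy.2]⟩ rfl

theorem isUnstableGraph {r : ℝ} (hr : r ≤ 1 / 50) :
    IsUnstableGraph r (fun a b x => xi ((a, b), x)) := by
  refine ⟨contDiffOn_xi.mono fun v hv => ?_, fun a b hab => ?_⟩
  · have hq := params_mono hr hv.1
    have hy := yFix_mem (a := v.1.1) (b := v.1.2) hq
    exact ⟨hq, by linarith [hv.2.1], by linarith [hv.2.2, hy.2]⟩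
  · have hq := params_mono hr hab
    have hy := yFix_mem hq
    refine ⟨fun x hx => (xi_mem_Wu (v := ((a, b), x)) ⟨hq, by linarith [hx.1],
      by linarith [hx.2, hy.2]⟩).2, by linarith [hy.1], xi_yFix hq⟩

/-! ### Sheets of the unstable set and their heights -/

theorem tDeriv_eq_of_hasDerivAt {E : Type*} [NormedAddCommGroup E] [NormedSpace ℝ E]
    {f : E × ℝ → ℝ} {U : Set (E × ℝ)} (hU : IsOpen U) (hf : ContDiffOn ℝ ∞ f U) {e : E} {t d : ℝ}
    (ht : (e, t) ∈ U) (h : HasDerivAt (fun s => f (e, s)) d t) : tDeriv f (e, t) = d :=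
  (hasDerivAt_tDeriv ((hf.contDiffAt (hU.mem_nhds ht)).differentiableAt (by simp))).unique h

/-- The parameters `a = -2`, `b = 0` and the time `t = 0`. -/
def base : (ℝ × ℝ) × ℝ := ((-2, 0), 0)

theorem base_mem_params {r : ℝ} (hr : 0 < r) : ((-2 : ℝ), (0 : ℝ)) ∈ params r :=
  mem_params.2 ⟨by simpa, by simpa⟩

/-- The graph over the ordinate axis obtained by mapping the points `(k v, v.2)`. -/
def sheet (k : (ℝ × ℝ) × ℝ → ℝ) (v : (ℝ × ℝ) × ℝ) : ℝ := v.1.1 - v.1.2 * k v + v.2 ^ 2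

/-- The height over the stable graph of the image of the graph of `sheet k`. -/
def sheetTheta (k : (ℝ × ℝ) × ℝ → ℝ) (v : (ℝ × ℝ) × ℝ) : ℝ :=
  v.1.1 - v.1.2 * v.2 + sheet k v ^ 2 - eta (v.1, sheet k v)

/-- `k` is smooth on `V`, the graph of `sheet k` is in the unstable set and close to the height
`-2`, and the heights of its image over the stable graph are strictly concave. -/
structure IsSheet (k : (ℝ × ℝ) × ℝ → ℝ) (V : Set ((ℝ × ℝ) × ℝ)) : Prop where
  isOpen : IsOpen V
  smooth : ContDiffOn ℝ ∞ k V
  mem_params : ∀ v ∈ V, v.1 ∈ params (1 / 50)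
  sheet_mem : ∀ v ∈ V, sheet k v ∈ Ioo (-(5 / 2) : ℝ) (-(3 / 2))
  mem_Wu : ∀ v ∈ V, (v.2, sheet k v) ∈ Wu v.1.1 v.1.2
  contDiffOn_theta : ContDiffOn ℝ ∞ (sheetTheta k) V
  tDeriv_tDeriv_neg : ∀ v ∈ V, tDeriv (tDeriv (sheetTheta k)) v < 0

theorem IsSheet.mono {k : (ℝ × ℝ) × ℝ → ℝ} {A B : Set ((ℝ × ℝ) × ℝ)} (h : IsSheet k A)
    (hB : IsOpen B) (hBA : B ⊆ A) : IsSheet k B :=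
  ⟨hB, h.smooth.mono hBA, fun v hv => h.mem_params v (hBA hv),
    fun v hv => h.sheet_mem v (hBA hv), fun v hv => h.mem_Wu v (hBA hv),
    h.contDiffOn_theta.mono hBA, fun v hv => h.tDeriv_tDeriv_neg v (hBA hv)⟩

theorem contDiffOn_sheet {k : (ℝ × ℝ) × ℝ → ℝ} {V : Set ((ℝ × ℝ) × ℝ)} (hk : ContDiffOn ℝ ∞ k V) :
    ContDiffOn ℝ ∞ (sheet k) V := by
  have h1 : ContDiff ℝ ∞ (fun v : (ℝ × ℝ) × ℝ => v.1.1) := by fun_prop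
  have h2 : ContDiff ℝ ∞ (fun v : (ℝ × ℝ) × ℝ => v.1.2) := by fun_prop
  have h3 : ContDiff ℝ ∞ (fun v : (ℝ × ℝ) × ℝ => v.2 ^ 2) := by fun_prop
  exact (h1.contDiffOn.sub (h2.contDiffOn.mul hk)).add h3.contDiffOn

theorem sheet_zero (k : (ℝ × ℝ) × ℝ → ℝ) (a t : ℝ) : sheet k ((a, 0), t) = a + t ^ 2 := by
  simp [sheet]

/-- At `b = 0` the function `k` drops out and the stable graph is constant, so all sheets share one
explicit height. -/
theorem sheetTheta_zero {k : (ℝ × ℝ) × ℝ → ℝ} {a t : ℝ} (ha : (a, (0 : ℝ)) ∈ params (1 / 50))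
    (h : sheet k ((a, 0), t) ∈ Ioo (-3 : ℝ) 3) :
    sheetTheta k ((a, 0), t) = a + (a + t ^ 2) ^ 2 - yFix a 0 := by
  have := eta_eq_yFix (v := ((a, 0), sheet k ((a, 0), t))) ⟨ha, h⟩ (by simp)
  simp only [sheetTheta, this]
  rw [sheet_zero]
  ring

theorem contDiffOn_sheetTheta {k : (ℝ × ℝ) × ℝ → ℝ} {V : Set ((ℝ × ℝ) × ℝ)}
    (hk : ContDiffOn ℝ ∞ k V) (hp : ∀ v ∈ V, v.1 ∈ params (1 / 50))
    (hs : ∀ v ∈ V, sheet k v ∈ Ioo (-3 : ℝ) 3) : ContDiffOn ℝ ∞ (sheetTheta k) V := by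
  have h1 : ContDiff ℝ ∞ (fun v : (ℝ × ℝ) × ℝ => v.1.1 - v.1.2 * v.2) := by fun_prop
  have h2 := contDiffOn_sheet hk
  exact (h1.contDiffOn.add (h2.pow 2)).sub
    (contDiffOn_eta.comp (contDiff_fst.contDiffOn.prodMk h2) fun v hv => ⟨hp v hv, hs v hv⟩)

theorem tDeriv_sheetTheta_zero {k : (ℝ × ℝ) × ℝ → ℝ} {V : Set ((ℝ × ℝ) × ℝ)} (hV : IsOpen V)
    (hk : ContDiffOn ℝ ∞ k V) (hp : ∀ v ∈ V, v.1 ∈ params (1 / 50))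
    (hs : ∀ v ∈ V, sheet k v ∈ Ioo (-3 : ℝ) 3) {a t : ℝ} (h : ((a, 0), t) ∈ V) :
    tDeriv (sheetTheta k) ((a, 0), t) = 4 * t * (a + t ^ 2) := by
  refine tDeriv_eq_of_hasDerivAt hV (contDiffOn_sheetTheta hk hp hs) h ?_
  have h1 : HasDerivAt (fun s : ℝ => a + (a + s ^ 2) ^ 2 - yFix a 0) (4 * t * (a + t ^ 2)) t := by
    have := ((((hasDerivAt_pow 2 t).const_add a).pow 2).const_add a).sub_const (yFix a 0)
    refine this.congr_deriv ?_
    norm_num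
    ring
  refine h1.congr_of_eventuallyEq ?_
  have hc : ContinuousAt (fun s : ℝ => ((a, (0 : ℝ)), s)) t := by fun_prop
  filter_upwards [hc.eventually (hV.mem_nhds h)] with s hs'
  exact sheetTheta_zero (hp _ hs') (hs _ hs')

/-- Since the value `-8` of the second derivative at `base` does not depend on `k`, every smooth
branch of unstable points `(k v, v.2)` gives a sheet after shrinking the domain. -/
theorem exists_isSheet {k : (ℝ × ℝ) × ℝ → ℝ} {V : Set ((ℝ × ℝ) × ℝ)} (hV : IsOpen V)
    (hb : base ∈ V) (hk : ContDiffOn ℝ ∞ k V) (hWu : ∀ v ∈ V, (k v, v.2) ∈ Wu v.1.1 v.1.2) :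
    ∃ V' ⊆ V, base ∈ V' ∧ IsSheet k V' := by
  set V₁ := V ∩ sheet k ⁻¹' Ioo (-(5 / 2)) (-(3 / 2)) ∩ (params (1 / 50) ×ˢ univ) with hV₁
  have hV₁o : IsOpen V₁ :=
    ((contDiffOn_sheet hk).continuousOn.isOpen_inter_preimage hV isOpen_Ioo).inter
      ((isOpen_params _).prod isOpen_univ)
  have hsub : V₁ ⊆ V := fun v hv => hv.1.1
  have hp : ∀ v ∈ V₁, v.1 ∈ params (1 / 50) := fun v hv => hv.2.1
  have hs : ∀ v ∈ V₁, sheet k v ∈ Ioo (-(5 / 2) : ℝ) (-(3 / 2)) := fun v hv => hv.1.2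
  have hs' : ∀ v ∈ V₁, sheet k v ∈ Ioo (-3 : ℝ) 3 := fun v hv =>
    ⟨by linarith [(hs v hv).1], by linarith [(hs v hv).2]⟩
  have hbase : base ∈ V₁ := by
    refine ⟨⟨hb, ?_⟩, base_mem_params (by norm_num), mem_univ _⟩
    rw [mem_preimage, base, sheet_zero]
    constructor <;> norm_num
  have hθ := contDiffOn_sheetTheta (hk.mono hsub) hp hs'
  have hθ₁ := contDiffOn_tDeriv hV₁o hθ
  have hθ₂ := contDiffOn_tDeriv hV₁o hθ₁
  have hval : tDeriv (tDeriv (sheetTheta k)) base = -8 := by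
    refine tDeriv_eq_of_hasDerivAt hV₁o hθ₁ hbase ?_
    have h1 : HasDerivAt (fun s : ℝ => 4 * s * (-2 + s ^ 2)) (-8) 0 := by
      have := ((hasDerivAt_id (0 : ℝ)).const_mul 4).mul ((hasDerivAt_pow 2 (0 : ℝ)).const_add (-2))
      refine this.congr_deriv ?_
      norm_num
    refine h1.congr_of_eventuallyEq ?_
    have hc : ContinuousAt (fun s : ℝ => (((-2 : ℝ), (0 : ℝ)), s)) 0 := by fun_prop
    filter_upwards [hc.eventually (hV₁o.mem_nhds hbase)] with s hs1
    exact tDeriv_sheetTheta_zero hV₁o (hk.mono hsub) hp hs' hs1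
  set V₂ := V₁ ∩ tDeriv (tDeriv (sheetTheta k)) ⁻¹' Iio 0 with hV₂
  have hV₂o : IsOpen V₂ := hθ₂.continuousOn.isOpen_inter_preimage hV₁o isOpen_Iio
  have h21 : V₂ ⊆ V₁ := inter_subset_left
  refine ⟨V₂, h21.trans hsub, ⟨hbase, by rw [mem_preimage, hval]; norm_num⟩, hV₂o,
    hk.mono (h21.trans hsub), fun v hv => hp v (h21 hv), fun v hv => hs v (h21 hv),
    fun v hv => phi_mem_Wu (hWu v (hsub (h21 hv))), hθ.mono h21, fun v hv => hv.2⟩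

/-! ### The three sheets -/

theorem contDiffOn_xi_fst_snd : ContDiffOn ℝ ∞
    (fun p : ((ℝ × ℝ) × ℝ) × ℝ => xi (p.1.1, p.2)) {p | (p.1.1, p.2) ∈ unstableDom} := by
  have h : ContDiff ℝ ∞ (fun p : ((ℝ × ℝ) × ℝ) × ℝ => (p.1.1, p.2)) := by fun_prop
  exact contDiffOn_xi.comp h.contDiffOn fun p hp => hp

theorem isOpen_unstableDom_fst_snd (c d : ℝ) :
    IsOpen {p : ((ℝ × ℝ) × ℝ) × ℝ | p.1.1 ∈ params (1 / 50) ∧ p.2 ∈ Ioo c d} := by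
  have h : Continuous (fun p : ((ℝ × ℝ) × ℝ) × ℝ => (p.1.1, p.2)) := by fun_prop
  exact ((isOpen_params _).prod isOpen_Ioo).preimage h

theorem xi_zero (a x : ℝ) : xi ((a, 0), x) = a + x ^ 2 := by simp [xi]

theorem sqrt_two_bounds : (14 / 10 : ℝ) < √2 ∧ √2 < (15 / 10 : ℝ) :=
  ⟨Real.lt_sqrt_of_sq_lt (by norm_num), by rw [Real.sqrt_lt' (by norm_num)]; norm_num⟩

/-- The left branch of the inverse of `xi`. -/
theorem exists_left_branch : ∃ (k : (ℝ × ℝ) × ℝ → ℝ) (V : Set ((ℝ × ℝ) × ℝ)), IsOpen V ∧ base ∈ V ∧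
    ContDiffOn ℝ ∞ k V ∧ ∀ v ∈ V, v.1 ∈ params (1 / 50) ∧ k v ∈ Ioo (-(7 / 4) : ℝ) (-(5 / 4)) ∧
      xi (v.1, k v) = v.2 := by
  -- The bounds wanted for `k` are built into the open set, so that the implicit function, whose
  -- graph stays in it, inherits them.
  set U := {p : ((ℝ × ℝ) × ℝ) × ℝ | p.1.1 ∈ params (1 / 50) ∧ p.2 ∈ Ioo (-(7 / 4) : ℝ) (-(5 / 4))}
  have hU : IsOpen U := isOpen_unstableDom_fst_snd _ _
  have hUX : U ⊆ {p | (p.1.1, p.2) ∈ unstableDom} := fun p hp =>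
    ⟨hp.1, by linarith [hp.2.1], by linarith [hp.2.2]⟩
  have h2 := sqrt_two_bounds
  have hsq : (√2 : ℝ) ^ 2 = 2 := Real.sq_sqrt (by norm_num)
  have hb : (base, -√2) ∈ U :=
    ⟨base_mem_params (by norm_num), by linarith, by linarith⟩
  have h3 : ContDiff ℝ ∞ (fun p : ((ℝ × ℝ) × ℝ) × ℝ => p.1.2) := by fun_prop
  have hf : ContDiffOn ℝ ∞ (fun p : ((ℝ × ℝ) × ℝ) × ℝ => xi (p.1.1, p.2) - p.1.2) U :=
    (contDiffOn_xi_fst_snd.mono hUX).sub h3.contDiffOn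
  have hd : tDeriv (fun p : ((ℝ × ℝ) × ℝ) × ℝ => xi (p.1.1, p.2) - p.1.2) (base, -√2) =
      -(2 * √2) := by
    refine tDeriv_eq_of_hasDerivAt hU hf hb ?_
    simp only [base, xi_zero]
    refine (((hasDerivAt_pow 2 (-√2)).const_add (-2)).sub_const 0).congr_deriv ?_
    norm_num
  obtain ⟨k, V, hV, hbV, hk, -, hkV⟩ := exists_implicit_real hU hf hb (by rw [hd]; linarith)
  refine ⟨k, V, hV, hbV, hk, fun v hv => ⟨(hkV v hv).1.1, (hkV v hv).1.2, ?_⟩⟩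
  have := (hkV v hv).2
  simp only [base, xi_zero] at this
  linarith [neg_sq (√2)]

/-- A second preimage branch, on which both preimages have negative abscissa. -/
theorem exists_second_left_branch : ∃ (u : (ℝ × ℝ) × ℝ → ℝ) (V : Set ((ℝ × ℝ) × ℝ)), IsOpen V ∧
    base ∈ V ∧ ContDiffOn ℝ ∞ u V ∧ ∀ v ∈ V, (v.1, u v) ∈ unstableDom ∧ u v < 0 ∧
      xi (v.1, u v) < 0 ∧ v.1.1 - v.1.2 * u v + xi (v.1, u v) ^ 2 = v.2 := by
  have h2 := sqrt_two_bounds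
  have hsq : (√2 : ℝ) ^ 2 = 2 := Real.sq_sqrt (by norm_num)
  -- At `base` the equation is `-2 + (-2 + u²)² = 0`; the root `u = -w` has `-2 + u² = -√2`, so that
  -- `u` and `xi` are both negative.
  set w : ℝ := √(2 - √2) with hw
  have hw1 : w ^ 2 = 2 - √2 := Real.sq_sqrt (by linarith)
  have hw0 : 0 < w := Real.sqrt_pos.2 (by linarith)
  have hw2 : w < 1 := by nlinarith
  set U₀ := {p : ((ℝ × ℝ) × ℝ) × ℝ | p.1.1 ∈ params (1 / 50) ∧ p.2 ∈ Ioo (-1 : ℝ) 0} with hU₀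
  have hU₀o : IsOpen U₀ := isOpen_unstableDom_fst_snd _ _
  have hUX : U₀ ⊆ {p | (p.1.1, p.2) ∈ unstableDom} := fun p hp =>
    ⟨hp.1, by linarith [hp.2.1], by linarith [hp.2.2]⟩
  have hxi := contDiffOn_xi_fst_snd.mono hUX
  set U := U₀ ∩ (fun p : ((ℝ × ℝ) × ℝ) × ℝ => xi (p.1.1, p.2)) ⁻¹' Iio 0 with hUdef
  have hU : IsOpen U := hxi.continuousOn.isOpen_inter_preimage hU₀o isOpen_Iio
  have hb : (base, -w) ∈ U := by
    refine ⟨⟨base_mem_params (by norm_num), by linarith, by linarith⟩, ?_⟩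
    simp only [base, mem_preimage, xi_zero, mem_Iio]
    nlinarith
  have h3 : ContDiff ℝ ∞ (fun p : ((ℝ × ℝ) × ℝ) × ℝ => p.1.1.1 - p.1.1.2 * p.2) := by fun_prop
  have h4 : ContDiff ℝ ∞ (fun p : ((ℝ × ℝ) × ℝ) × ℝ => p.1.2) := by fun_prop
  have hf : ContDiffOn ℝ ∞ (fun p : ((ℝ × ℝ) × ℝ) × ℝ =>
      p.1.1.1 - p.1.1.2 * p.2 + xi (p.1.1, p.2) ^ 2 - p.1.2) U :=
    (h3.contDiffOn.add ((hxi.mono inter_subset_left).pow 2)).sub h4.contDiffOn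
  have hd : tDeriv (fun p : ((ℝ × ℝ) × ℝ) × ℝ =>
      p.1.1.1 - p.1.1.2 * p.2 + xi (p.1.1, p.2) ^ 2 - p.1.2) (base, -w) = 4 * √2 * w := by
    refine tDeriv_eq_of_hasDerivAt hU hf hb ?_
    simp only [base, xi_zero, zero_mul]
    refine ((((((hasDerivAt_pow 2 (-w)).const_add (-2)).pow 2).const_add (-2 - 0))).sub_const
      0).congr_deriv ?_
    norm_num
    rw [hw1]
    ring
  obtain ⟨k, V, hV, hbV, hk, -, hkV⟩ := exists_implicit_real hU hf hb (by rw [hd]; positivity)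
  refine ⟨k, V, hV, hbV, hk, fun v hv => ⟨hUX (hkV v hv).1.1, (hkV v hv).1.1.2.2,
    (hkV v hv).1.2, ?_⟩⟩
  have := (hkV v hv).2
  simp only [base, xi_zero, neg_sq, hw1] at this
  nlinarith

/-- The sheets used in the proof: `k` gives the return graph, and for either sign of `b` there is
another sheet, lying below it. -/
theorem exists_sheets : ∃ (k k₁ k₂ : (ℝ × ℝ) × ℝ → ℝ) (V : Set ((ℝ × ℝ) × ℝ)), base ∈ V ∧
    IsSheet k V ∧ IsSheet k₁ V ∧ IsSheet k₂ V ∧ ∀ v ∈ V,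
      k v ∈ Ioo (-(7 / 4) : ℝ) (-(5 / 4)) ∧ xi (v.1, k v) = v.2 ∧
      (0 < v.1.2 → sheet k₁ v < sheet k v) ∧ (v.1.2 < 0 → sheet k₂ v < sheet k v) := by
  obtain ⟨k, V, hV, hbV, hk, hkV⟩ := exists_left_branch
  obtain ⟨u, W, hW, hbW, hu, huW⟩ := exists_second_left_branch
  have hdom : ∀ v ∈ V, (v.1, k v) ∈ unstableDom := fun v hv =>
    ⟨(hkV v hv).1, by linarith [(hkV v hv).2.1.1], by linarith [(hkV v hv).2.1.2]⟩
  have hbX : base ∈ unstableDom := ⟨base_mem_params (by norm_num), by norm_num [base], by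
    norm_num [base]⟩
  obtain ⟨V₀, hV₀, hb₀, hs₀⟩ := exists_isSheet hV hbV hk fun v hv => by
    have := (xi_mem_Wu (hdom v hv)).2
    rwa [(hkV v hv).2.2] at this
  obtain ⟨V₁, hV₁, hb₁, hs₁⟩ := exists_isSheet isOpen_unstableDom hbX contDiffOn_pre
    fun v hv => (xi_mem_Wu hv).1
  have hu' : ContDiffOn ℝ ∞ (fun v => xi (v.1, u v)) W :=
    contDiffOn_xi.comp (contDiff_fst.contDiffOn.prodMk hu) fun v hv => (huW v hv).1
  obtain ⟨V₂, hV₂, hb₂, hs₂⟩ := exists_isSheet hW hbW hu' fun v hv => by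
    have := phi_mem_Wu (xi_mem_Wu (huW v hv).1).2
    rw [phi] at this
    simp only at this
    rwa [(huW v hv).2.2.2] at this
  have ho : IsOpen (V₀ ∩ (V₁ ∩ V₂)) := hs₀.isOpen.inter (hs₁.isOpen.inter hs₂.isOpen)
  -- Near `base` the abscissas `k`, `k₁`, `k₂` are close to `-√2`, `√2` and `-√2`.
  refine ⟨k, pre, fun v => xi (v.1, u v), V₀ ∩ (V₁ ∩ V₂), ⟨hb₀, hb₁, hb₂⟩,
    hs₀.mono ho fun v hv => hv.1, hs₁.mono ho fun v hv => hv.2.1, hs₂.mono ho fun v hv => hv.2.2,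
    fun v hv => ?_⟩
  obtain ⟨-, hk1, hk2⟩ := hkV v (hV₀ hv.1)
  obtain ⟨-, hu1, hu2, hu3⟩ := huW v (hV₂ hv.2.2)
  refine ⟨hk1, hk2, fun hb => ?_, fun hb => ?_⟩
  -- For `b > 0` it suffices that `pre` is positive and `k` negative.
  · have := pre_pos (hV₁ hv.2.1)
    simp only [sheet]
    nlinarith [hk1.2]
  -- For `b < 0`, both branches have ordinate `v.2`, so `k² - b pre(k) = xi(u)² - b u`. As `pre(k) >
  -- 0 > u`, this gives `k² < xi(u)²`, hence `xi(u) < k < 0`.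
  · have hg := pre_pos (hdom v (hV₀ hv.1))
    have h1 : v.1.1 - v.1.2 * pre (v.1, k v) + k v ^ 2 = v.2 := hk2
    have h2 : k v ^ 2 < xi (v.1, u v) ^ 2 := by nlinarith
    have h3 : xi (v.1, u v) < k v := by nlinarith [hk1.2]
    simp only [sheet]
    nlinarith

/-! ### Monotonicity, concavity and transverse crossings -/

theorem mem_stableDom_of_mem {q : ℝ × ℝ} (hq : q ∈ params (1 / 50)) {x : ℝ}
    (hx : x ∈ Icc (-(5 / 2) : ℝ) (5 / 2)) : (q, x) ∈ stableDom :=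
  ⟨hq, by linarith [hx.1], by linarith [hx.2]⟩

theorem hasDerivAt_of_contDiffOn {E : Type*} [NormedAddCommGroup E] [NormedSpace ℝ E]
    {f : E × ℝ → ℝ} {U : Set (E × ℝ)} (hU : IsOpen U) (hf : ContDiffOn ℝ ∞ f U) {e : E} {t : ℝ}
    (ht : (e, t) ∈ U) : HasDerivAt (fun s => f (e, s)) (tDeriv f (e, t)) t :=
  hasDerivAt_tDeriv ((hf.contDiffAt (hU.mem_nhds ht)).differentiableAt (by simp))

theorem abs_tDeriv_eta_le {q : ℝ × ℝ} (hq : q ∈ params (1 / 50)) {x : ℝ} (hx : x ∈ Ioo (-3 : ℝ) 3) :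
    |tDeriv eta (q, x)| ≤ 1 := by
  refine (hasDerivAt_of_contDiffOn isOpen_stableDom contDiffOn_eta
    (show (q, x) ∈ stableDom from ⟨hq, hx⟩)).le_of_lip' zero_le_one ?_
  filter_upwards [isOpen_Ioo.mem_nhds hx] with y hy
  rw [one_mul]
  exact abs_eta_sub_le hq hy hx

/-- The height over the stable graph is strictly decreasing along `-5/2 < x < -3/2`. -/
theorem sq_sub_eta_lt {q : ℝ × ℝ} (hq : q ∈ params (1 / 50)) {x y : ℝ}
    (hx : x ∈ Ioo (-(5 / 2) : ℝ) (-(3 / 2))) (hy : y ∈ Ioo (-(5 / 2) : ℝ) (-(3 / 2))) (h : x < y) :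
    y ^ 2 - eta (q, y) < x ^ 2 - eta (q, x) := by
  have h1 := abs_eta_sub_le hq (x := x) (x' := y) ⟨by linarith [hx.1], by linarith [hx.2]⟩
    ⟨by linarith [hy.1], by linarith [hy.2]⟩
  have h2 := (abs_le.1 h1).2
  rw [abs_of_neg (by linarith)] at h2
  nlinarith [hx.2, hy.2]

theorem sq_sub_eta_inj {q : ℝ × ℝ} (hq : q ∈ params (1 / 50)) {x y : ℝ}
    (hx : x ∈ Ioo (-(5 / 2) : ℝ) (-(3 / 2))) (hy : y ∈ Ioo (-(5 / 2) : ℝ) (-(3 / 2)))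
    (h : x ^ 2 - eta (q, x) = y ^ 2 - eta (q, y)) : x = y := by
  rcases lt_trichotomy x y with h1 | h1 | h1
  · linarith [sq_sub_eta_lt hq hx hy h1]
  · exact h1
  · linarith [sq_sub_eta_lt hq hy hx h1]

namespace IsSheet

variable {k : (ℝ × ℝ) × ℝ → ℝ} {V : Set ((ℝ × ℝ) × ℝ)} {q : ℝ × ℝ} {t : ℝ}

theorem hasDerivAt_sheet (h : IsSheet k V) (ht : (q, t) ∈ V) :
    HasDerivAt (fun s => sheet k (q, s)) (tDeriv (sheet k) (q, t)) t :=
  hasDerivAt_of_contDiffOn h.isOpen (contDiffOn_sheet h.smooth) ht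

theorem hasDerivAt_theta (h : IsSheet k V) (ht : (q, t) ∈ V) :
    HasDerivAt (fun s => sheetTheta k (q, s)) (tDeriv (sheetTheta k) (q, t)) t :=
  hasDerivAt_of_contDiffOn h.isOpen h.contDiffOn_theta ht

theorem mem_Icc (h : IsSheet k V) (ht : (q, t) ∈ V) :
    sheet k (q, t) ∈ Icc (-(5 / 2) : ℝ) (5 / 2) := by
  have := h.sheet_mem _ ht
  exact ⟨this.1.le, by linarith [this.2]⟩

theorem tDeriv_theta (h : IsSheet k V) (ht : (q, t) ∈ V) :
    tDeriv (sheetTheta k) (q, t) = -q.2 + 2 * sheet k (q, t) * tDeriv (sheet k) (q, t) -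
      tDeriv eta (q, sheet k (q, t)) * tDeriv (sheet k) (q, t) := by
  refine (h.hasDerivAt_theta ht).unique ?_
  have h1 := h.hasDerivAt_sheet ht
  have h2 := (hasDerivAt_of_contDiffOn isOpen_stableDom contDiffOn_eta
    (mem_stableDom_of_mem (h.mem_params _ ht) (h.mem_Icc ht))).comp t h1
  have h3 := ((((hasDerivAt_id t).const_mul q.2).const_sub q.1).add (h1.pow 2)).sub h2
  refine h3.congr_deriv ?_
  norm_num

theorem strictAntiOn_tDeriv (h : IsSheet k V) {I : Set ℝ} (hI : Convex ℝ I)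
    (hIV : ∀ s ∈ I, (q, s) ∈ V) : StrictAntiOn (fun s => tDeriv (sheetTheta k) (q, s)) I := by
  have hd : ∀ s ∈ I, HasDerivAt (fun s => tDeriv (sheetTheta k) (q, s))
      (tDeriv (tDeriv (sheetTheta k)) (q, s)) s := fun s hs =>
    hasDerivAt_of_contDiffOn h.isOpen (contDiffOn_tDeriv h.isOpen h.contDiffOn_theta) (hIV s hs)
  refine strictAntiOn_of_deriv_neg hI
    (fun s hs => (hd s hs).continuousAt.continuousWithinAt) fun s hs => ?_
  rw [(hd s (interior_subset hs)).deriv]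
  exact h.tDeriv_tDeriv_neg _ (hIV s (interior_subset hs))

/-- A critical point of the height is its unique maximum. -/
theorem theta_lt (h : IsSheet k V) {I : Set ℝ} (hI : Convex ℝ I) (hIV : ∀ s ∈ I, (q, s) ∈ V)
    {x : ℝ} (hx : x ∈ I) (hcrit : tDeriv (sheetTheta k) (q, x) = 0) (ht : t ∈ I) (hne : t ≠ x) :
    sheetTheta k (q, t) < sheetTheta k (q, x) := by
  have hanti := h.strictAntiOn_tDeriv hI hIV
  rcases lt_or_gt_of_ne hne with hlt | hlt
  · have hsub : Icc t x ⊆ I := hI.ordConnected.out ht hx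
    obtain ⟨c, hc, hc'⟩ := exists_hasDerivAt_eq_slope (fun s => sheetTheta k (q, s)) _ hlt
      (fun s hs => (h.hasDerivAt_theta (hIV s (hsub hs))).continuousAt.continuousWithinAt)
      fun s hs => h.hasDerivAt_theta (hIV s (hsub (Ioo_subset_Icc_self hs)))
    have h1 := hanti (hsub (Ioo_subset_Icc_self hc)) hx hc.2
    simp only [hcrit, hc'] at h1
    have := (div_pos_iff_of_pos_right (by linarith)).1 h1
    linarith
  · have hsub : Icc x t ⊆ I := hI.ordConnected.out hx ht
    obtain ⟨c, hc, hc'⟩ := exists_hasDerivAt_eq_slope (fun s => sheetTheta k (q, s)) _ hlt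
      (fun s hs => (h.hasDerivAt_theta (hIV s (hsub hs))).continuousAt.continuousWithinAt)
      fun s hs => h.hasDerivAt_theta (hIV s (hsub (Ioo_subset_Icc_self hs)))
    have h1 := hanti hx (hsub (Ioo_subset_Icc_self hc)) hc.1
    simp only [hcrit, hc'] at h1
    have := (div_lt_iff₀ (by linarith : (0 : ℝ) < t - x)).1 h1
    linarith

end IsSheet

theorem linearIndependent_of_det_ne_zero {u v : ℝ × ℝ} (h : u.1 * v.2 - u.2 * v.1 ≠ 0) :
    LinearIndependent ℝ ![u, v] := by
  rw [LinearIndependent.pair_iff]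
  intro s t hst
  have h1 := congrArg Prod.fst hst
  have h2 := congrArg Prod.snd hst
  simp only [Prod.fst_add, Prod.snd_add, Prod.smul_fst, Prod.smul_snd, smul_eq_mul, Prod.fst_zero,
    Prod.snd_zero] at h1 h2
  constructor
  · refine (mul_eq_zero.1 (?_ : s * (u.1 * v.2 - u.2 * v.1) = 0)).resolve_right h
    linear_combination v.2 * h1 - v.1 * h2
  · refine (mul_eq_zero.1 (?_ : t * (u.1 * v.2 - u.2 * v.1) = 0)).resolve_right h
    linear_combination u.1 * h2 - u.2 * h1

theorem hasDerivAt_add_mul (x ρ s : ℝ) : HasDerivAt (fun σ => x + ρ * σ) ρ s := by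
  simpa using ((hasDerivAt_id s).const_mul ρ).const_add x

/-- A sheet that passes from above to below the stable graph crosses it transversally. -/
theorem IsSheet.exists_transverse {k : (ℝ × ℝ) × ℝ → ℝ} {V : Set ((ℝ × ℝ) × ℝ)} (h : IsSheet k V)
    {q : ℝ × ℝ} {t₀ t₁ : ℝ} (hlt : t₀ < t₁) (hV : ∀ t ∈ Icc t₀ t₁, (q, t) ∈ V)
    (h0 : 0 < sheetTheta k (q, t₀)) (h1 : sheetTheta k (q, t₁) < 0) :
    ∃ z, z ≠ pFix q.1 q.2 ∧ IsTransverseIntersection (Wu q.1 q.2) (Ws q.1 q.2) z := by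
  have hq := h.mem_params _ (hV t₀ (left_mem_Icc.2 hlt.le))
  obtain ⟨t, ht, hzero⟩ := intermediate_value_Ioo' hlt.le
    (fun s hs => (h.hasDerivAt_theta (hV s hs)).continuousAt.continuousWithinAt)
    (show (0 : ℝ) ∈ Ioo (sheetTheta k (q, t₁)) (sheetTheta k (q, t₀)) from ⟨h1, h0⟩)
  simp only at hzero
  have htV := hV t (Ioo_subset_Icc_self ht)
  -- The height falls from a positive value to `0` on `[t₀, t]`, so its slope is negative somewhere
  -- there, and by concavity also at `t`.
  have hneg : tDeriv (sheetTheta k) (q, t) < 0 := by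
    obtain ⟨c, hc, hc'⟩ := exists_hasDerivAt_eq_slope (fun s => sheetTheta k (q, s)) _ ht.1
      (fun s hs => (h.hasDerivAt_theta (hV s ⟨hs.1, hs.2.trans ht.2.le⟩)).continuousAt.continuousWithinAt)
      fun s hs => h.hasDerivAt_theta (hV s ⟨hs.1.le, hs.2.le.trans ht.2.le⟩)
    have h2 := h.strictAntiOn_tDeriv (convex_Icc t₀ t₁) hV ⟨hc.1.le, hc.2.le.trans ht.2.le⟩
      (Ioo_subset_Icc_self ht) hc.2
    simp only [hc', hzero] at h2
    have h3 : (0 - sheetTheta k (q, t₀)) / (t - t₀) < 0 :=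
      div_neg_of_neg_of_pos (by linarith) (by linarith [ht.1])
    linarith
  -- The scales `ρ` and `1/4` keep both arcs inside their domains for all parameters in `(-1, 1)`.
  set ρ := min (t - t₀) (t₁ - t) with hρ
  have hρ0 : 0 < ρ := lt_min (by linarith [ht.1]) (by linarith [ht.2])
  have hmem : ∀ σ ∈ Ioo (-1 : ℝ) 1, (q, t + ρ * σ) ∈ V := by
    intro σ hσ
    have h2 : ρ ≤ t - t₀ := min_le_left _ _
    have h3 : ρ ≤ t₁ - t := min_le_right _ _
    refine hV _ ⟨by nlinarith [hσ.1], by nlinarith [hσ.2]⟩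
  have hz := h.sheet_mem _ htV
  have hmem' : ∀ σ ∈ Ioo (-1 : ℝ) 1, (q, sheet k (q, t) + 1 / 4 * σ) ∈ stableDom := fun σ hσ =>
    ⟨hq, by simp only; linarith [hz.1, hσ.1], by simp only; linarith [hz.2, hσ.2]⟩
  have hcurve : ContDiffOn ℝ ∞ (fun σ => sheet k (q, t + ρ * σ)) (Ioo (-1) 1) :=
    (contDiffOn_sheet h.smooth).comp
      (by fun_prop : ContDiff ℝ ∞ fun σ : ℝ => (q, t + ρ * σ)).contDiffOn hmem
  refine ⟨(sheet k (q, t), eta (q, sheet k (q, t))), ?_,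
    fun σ => phi q.1 q.2 (t + ρ * σ, sheet k (q, t + ρ * σ)),
    fun σ => (sheet k (q, t) + 1 / 4 * σ, eta (q, sheet k (q, t) + 1 / 4 * σ)), ?_, ?_, ?_, ?_, ?_,
    ?_, ?_⟩
  · intro he
    have h2 : sheet k (q, t) = yFix q.1 q.2 := congrArg Prod.fst he
    have h3 := yFix_mem (a := q.1) (b := q.2) hq
    linarith [hz.2, h3.1]
  · exact (contDiff_phi q.1 q.2).comp_contDiffOn
      ((by fun_prop : ContDiff ℝ ∞ fun σ : ℝ => t + ρ * σ).contDiffOn.prodMk hcurve)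
  · exact (by fun_prop : ContDiff ℝ ∞ fun σ : ℝ => sheet k (q, t) + 1 / 4 * σ).contDiffOn.prodMk
      (contDiffOn_eta.comp (by fun_prop : ContDiff ℝ ∞ fun σ : ℝ =>
        (q, sheet k (q, t) + 1 / 4 * σ)).contDiffOn hmem')
  · rintro _ ⟨σ, hσ, rfl⟩
    exact phi_mem_Wu (h.mem_Wu _ (hmem σ hσ))
  · rintro _ ⟨σ, hσ, rfl⟩
    exact eta_mem_Ws (hmem' σ hσ)
  · simp only [mul_zero, add_zero, phi]
    refine Prod.ext rfl ?_
    simp only [sheetTheta] at hzero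
    simp only
    linarith
  · simp
  · have d1 : HasDerivAt (fun σ => sheet k (q, t + ρ * σ)) (tDeriv (sheet k) (q, t) * ρ) 0 := by
      have := h.hasDerivAt_sheet htV
      rw [show t = t + ρ * 0 by ring] at this
      simpa [Function.comp_def] using this.comp 0 (hasDerivAt_add_mul t ρ 0)
    have d2 : HasDerivAt (fun σ => phi q.1 q.2 (t + ρ * σ, sheet k (q, t + ρ * σ)))
        (tDeriv (sheet k) (q, t) * ρ,
          -(q.2 * ρ) + 2 * sheet k (q, t) * (tDeriv (sheet k) (q, t) * ρ)) 0 := by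
      have := d1.prodMk ((((hasDerivAt_add_mul t ρ 0).const_mul q.2).const_sub q.1).add (d1.pow 2))
      refine this.congr_deriv ?_
      simp
    have d3 : HasDerivAt (fun σ => (sheet k (q, t) + 1 / 4 * σ, eta (q, sheet k (q, t) + 1 / 4 * σ)))
        (1 / 4, tDeriv eta (q, sheet k (q, t)) * (1 / 4)) 0 := by
      have d4 := hasDerivAt_of_contDiffOn isOpen_stableDom contDiffOn_eta
        (mem_stableDom_of_mem hq (h.mem_Icc htV))
      rw [show sheet k (q, t) = sheet k (q, t) + 1 / 4 * 0 by ring] at d4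
      have d5 := d4.comp 0 (hasDerivAt_add_mul (sheet k (q, t)) (1 / 4) 0)
      have d6 := (hasDerivAt_add_mul (sheet k (q, t)) (1 / 4) 0).prodMk d5
      simpa using d6
    rw [d2.deriv, d3.deriv]
    refine linearIndependent_of_det_ne_zero ?_
    simp only
    have h2 := h.tDeriv_theta htV
    -- The determinant of the two velocities is a nonzero multiple of the derivative of the height.
    have h3 : tDeriv (sheet k) (q, t) * ρ * (tDeriv eta (q, sheet k (q, t)) * (1 / 4)) -
        (-(q.2 * ρ) + 2 * sheet k (q, t) * (tDeriv (sheet k) (q, t) * ρ)) * (1 / 4) =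
        -(ρ / 4 * tDeriv (sheetTheta k) (q, t)) := by
      rw [h2]
      ring
    rw [h3]
    exact neg_ne_zero.2 (mul_ne_zero (by positivity) hneg.ne)

/-! ### Generic unfolding -/

theorem three_le_infty : (3 : ℕ∞ω) ≤ ∞ := by
  have h : ((3 : ℕ) : ℕ∞ω) ≤ ∞ := by
    rw [← WithTop.coe_natCast]
    exact WithTop.coe_le_coe.2 le_top
  simpa using h

/-- Freezing the parameter in a generic unfolding leaves a quadratic tangency. -/
theorem UnfoldsGenerically.isQuadraticTangency {A B : ℝ → Set (ℝ × ℝ)} {t₀ : ℝ} {q : ℝ × ℝ}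
    (h : UnfoldsGenerically A B t₀ q) : IsQuadraticTangency (A t₀) (B t₀) q := by
  obtain ⟨κ, O, Φ, γs, γu, c, β, hκ, hΦ, hq, hΦq, hc, hs, hu, -, hβ, -, hO⟩ := h
  have ht : t₀ ∈ Ioo (t₀ - κ) (t₀ + κ) := ⟨by linarith, by linarith⟩
  have hfreeze : ContDiff ℝ ∞ fun p : ℝ × (ℝ × ℝ) => (t₀, p.2) := by fun_prop
  have harc : ∀ {W : ℝ → Set (ℝ × ℝ)} {γ : ℝ → ℝ → ℝ × ℝ},
      IsArcFamily W (Ioo (t₀ - κ) (t₀ + κ)) γ →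
      IsArcFamily (fun _ => W t₀) univ (fun _ => γ t₀) := by
    intro W γ hγ
    refine ⟨?_, fun _ _ => hγ.2 t₀ ht⟩
    exact hγ.1.comp (by fun_prop : ContDiff ℝ ∞ fun p : ℝ × ℝ => (t₀, p.2)).contDiffOn
      fun p hp => ⟨ht, hp.2⟩
  refine ⟨O, Φ t₀, γs t₀, γu t₀, c, ⟨hΦ.1, ?_, fun _ _ => hΦ.2.2 t₀ ht⟩, hq, hΦq, hc, harc hs,
    harc hu, (hO t₀ ht).1, ?_⟩
  · exact hΦ.2.1.comp (hfreeze.of_le three_le_infty).contDiffOn fun p hp => ⟨ht, hp.2⟩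
  · have := (hO t₀ ht).2
    rwa [hβ, show {z | z ∈ O ∧ (Φ t₀ z).2 = c * (Φ t₀ z).1 ^ 2 + 0} =
      {z | z ∈ O ∧ (Φ t₀ z).2 = c * (Φ t₀ z).1 ^ 2} by simp] at this

/-- The time coordinate on the plane: `timeCoord a b (phi a b (t, x)) = t`. -/
def timeCoord (a b : ℝ) (z : ℝ × ℝ) : ℝ := (a + z.1 ^ 2 - z.2) / b

theorem timeCoord_phi {a b : ℝ} (hb : b ≠ 0) (z : ℝ × ℝ) : timeCoord a b (phi a b z) = z.1 := by
  simp only [timeCoord, phi]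
  field_simp
  ring

theorem eq_of_timeCoord {a b : ℝ} (hb : b ≠ 0) (z : ℝ × ℝ) :
    z.2 = a - b * timeCoord a b z + z.1 ^ 2 := by
  simp only [timeCoord]
  field_simp
  ring

theorem continuous_timeCoord (b : ℝ) : Continuous fun p : ℝ × (ℝ × ℝ) => timeCoord p.1 b p.2 := by
  unfold timeCoord
  fun_prop

theorem contDiff_timeCoord (b : ℝ) : ContDiff ℝ ∞ fun p : ℝ × (ℝ × ℝ) => timeCoord p.1 b p.2 := by
  unfold timeCoord
  exact ContDiff.div_const (by fun_prop) _

theorem hasFDerivAt_timeCoord (a b : ℝ) (z : ℝ × ℝ) : HasFDerivAt (timeCoord a b)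
    (b⁻¹ • ((2 * z.1) • ContinuousLinearMap.fst ℝ ℝ ℝ - ContinuousLinearMap.snd ℝ ℝ ℝ)) z := by
  have h1 : HasFDerivAt (fun w : ℝ × ℝ => w.2) (ContinuousLinearMap.snd ℝ ℝ ℝ) z := hasFDerivAt_snd
  have h2 : HasFDerivAt (fun w : ℝ × ℝ => w.1) (ContinuousLinearMap.fst ℝ ℝ ℝ) z := hasFDerivAt_fst
  have h3 := (((h2.pow 2).const_add a).sub h1).mul_const b⁻¹
  have h4 : HasFDerivAt (timeCoord a b) _ z := h3
  refine h4.congr_fderiv ?_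
  ext <;> simp

theorem derivWithin_ne_zero_of_hasDerivAt {γ : ℝ → ℝ × ℝ} {s : ℝ} {d : ℝ × ℝ}
    (hs : s ∈ Icc (-1 : ℝ) 1) (h : HasDerivAt γ d s) (hd : d ≠ 0) :
    derivWithin γ (Icc (-1) 1) s ≠ 0 := by
  rwa [h.hasDerivWithinAt.derivWithin (uniqueDiffOn_Icc (by norm_num) s hs)]

/-- The arc covers the abscissas `[-5/2, -3/2]`, hence all of the stable graph that a neighbourhood
with abscissas in this range can meet. -/
theorem isArcFamily_eta {b : ℝ} {J : Set ℝ} (hJ : ∀ a ∈ J, (a, b) ∈ params (1 / 50)) :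
    IsArcFamily (fun a => Ws a b) J (fun a s => (-2 + 1 / 2 * s, eta ((a, b), -2 + 1 / 2 * s))) := by
  have hmem : ∀ a ∈ J, ∀ s ∈ Icc (-1 : ℝ) 1, ((a, b), -2 + 1 / 2 * s) ∈ stableDom := fun a ha s hs =>
    ⟨hJ a ha, by simp only; linarith [hs.1], by simp only; linarith [hs.2]⟩
  refine ⟨?_, fun a ha => ⟨?_, fun s hs => ?_, ?_⟩⟩
  · exact (by fun_prop : ContDiff ℝ ∞ fun p : ℝ × ℝ => -2 + 1 / 2 * p.2).contDiffOn.prodMk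
      (contDiffOn_eta.comp (by fun_prop : ContDiff ℝ ∞ fun p : ℝ × ℝ =>
        ((p.1, b), -2 + 1 / 2 * p.2)).contDiffOn fun p hp => hmem _ hp.1 _ hp.2)
  · intro s _ s' _ h
    have := congrArg Prod.fst h
    simp only at this
    linarith
  · have d1 := hasDerivAt_add_mul (-2) (1 / 2) s
    have d2 := (hasDerivAt_of_contDiffOn isOpen_stableDom contDiffOn_eta (hmem a ha s hs)).comp s d1
    exact derivWithin_ne_zero_of_hasDerivAt hs (d1.prodMk d2) fun h0 => by
      have := congrArg Prod.fst h0
      norm_num at this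
  · rintro _ ⟨s, hs, rfl⟩
    exact eta_mem_Ws (hmem a ha s hs)

theorem IsSheet.isArcFamily {k : (ℝ × ℝ) × ℝ → ℝ} {V : Set ((ℝ × ℝ) × ℝ)} (h : IsSheet k V)
    {b δ : ℝ} (hb : b ≠ 0) (hδ : 0 < δ) {J : Set ℝ}
    (hJ : ∀ a ∈ J, ∀ t ∈ Icc (-δ) δ, ((a, b), t) ∈ V) :
    IsArcFamily (fun a => Wu a b) J
      (fun a s => phi a b (0 + δ * s, sheet k ((a, b), 0 + δ * s))) := by
  have hmem : ∀ a ∈ J, ∀ s ∈ Icc (-1 : ℝ) 1, ((a, b), 0 + δ * s) ∈ V := fun a ha s hs =>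
    hJ a ha _ ⟨by nlinarith [hs.1], by nlinarith [hs.2]⟩
  refine ⟨?_, fun a ha => ⟨?_, fun s hs => ?_, ?_⟩⟩
  · have h1 : ContDiffOn ℝ ∞ (fun p : ℝ × ℝ => sheet k ((p.1, b), 0 + δ * p.2)) (J ×ˢ Icc (-1) 1) :=
      (contDiffOn_sheet h.smooth).comp (by fun_prop : ContDiff ℝ ∞ fun p : ℝ × ℝ =>
        ((p.1, b), 0 + δ * p.2)).contDiffOn fun p hp => hmem _ hp.1 _ hp.2
    have h2 : ContDiff ℝ ∞ fun p : ℝ × ℝ => p.1 - b * (0 + δ * p.2) := by fun_prop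
    exact h1.prodMk (h2.contDiffOn.add (h1.pow 2))
  · intro s _ s' _ h
    have := congrArg (timeCoord a b) h
    simp only [timeCoord_phi hb] at this
    exact mul_left_cancel₀ hδ.ne' (by linarith)
  · have d0 := hasDerivAt_add_mul 0 δ s
    have d1 := (h.hasDerivAt_sheet (hmem a ha s hs)).comp s d0
    -- If the abscissa is stationary, the ordinate still moves with speed `-b δ`, which is nonzero.
    have d2 := d1.prodMk (((d0.const_mul b).const_sub a).add (d1.pow 2))
    refine derivWithin_ne_zero_of_hasDerivAt hs d2 fun h0 => ?_
    have h1 := congrArg Prod.fst h0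
    have h2 := congrArg Prod.snd h0
    simp only [Prod.fst_zero, Prod.snd_zero] at h1 h2
    rw [h1] at h2
    simp only [mul_zero, add_zero, neg_eq_zero] at h2
    exact mul_ne_zero hb hδ.ne' h2
  · rintro _ ⟨s, hs, rfl⟩
    exact phi_mem_Wu (h.mem_Wu _ (hmem a ha s hs))

theorem bijective_of_injective {T : (ℝ × ℝ) →L[ℝ] (ℝ × ℝ)} (h : ∀ v, T v = 0 → v = 0) :
    Function.Bijective T := by
  have hinj : Function.Injective (T : (ℝ × ℝ) →ₗ[ℝ] (ℝ × ℝ)) :=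
    (injective_iff_map_eq_zero _).2 h
  exact ⟨hinj, LinearMap.injective_iff_surjective.1 hinj⟩

/-- On the unstable arc the height over the stable graph at time `t` is `θ(t) = H - ψ(t)²`, where
`ψ` is the Morse coordinate. With `ψ` of `timeCoord` as first coordinate and the height as second,
the normal form holds with `c = -1` and `β = H(·, b)`. -/
theorem unfoldsGenerically {k : (ℝ × ℝ) × ℝ → ℝ} {r δ : ℝ} (hδ : 0 < δ)
    (hk : IsSheet k (params r ×ˢ Ioo (-(2 * δ)) (2 * δ))) {τ : ℝ × ℝ → ℝ}
    (hτ : ContDiffOn ℝ ∞ τ (params r)) (hτδ : ∀ q ∈ params r, τ q ∈ Ioo (-δ) δ)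
    (hcrit : ∀ q ∈ params r, tDeriv (sheetTheta k) (q, τ q) = 0)
    (hH : ContDiffOn ℝ ∞ (fun q => sheetTheta k (q, τ q)) (params r))
    {a₀ b : ℝ} (hb : b ≠ 0) (hab : (a₀, b) ∈ params r)
    (hH0 : sheetTheta k ((a₀, b), τ (a₀, b)) = 0)
    (hH1 : deriv (fun a => sheetTheta k ((a, b), τ (a, b))) a₀ ≠ 0) :
    UnfoldsGenerically (fun a => Ws a b) (fun a => Wu a b) a₀
      (phi a₀ b (τ (a₀, b), sheet k ((a₀, b), τ (a₀, b)))) := by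
  have hsub : params r ×ˢ Ioo (-δ) δ ⊆ params r ×ˢ Ioo (-(2 * δ)) (2 * δ) :=
    prod_mono le_rfl (Ioo_subset_Ioo (by linarith) (by linarith))
  have hWo : IsOpen (params r ×ˢ Ioo (-δ) δ) := (isOpen_params r).prod isOpen_Ioo
  obtain ⟨ψ, hψ, hψ'⟩ := exists_morse_coordinate (isOpen_params r)
    (hk.contDiffOn_theta.mono hsub) hτ hτδ hcrit fun v hv => hk.tDeriv_tDeriv_neg v (hsub hv)
  set q := phi a₀ b (τ (a₀, b), sheet k ((a₀, b), τ (a₀, b))) with hq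
  have hτ0 := hτδ _ hab
  have hmem0 : ((a₀, b), τ (a₀, b)) ∈ params r ×ˢ Ioo (-δ) δ := ⟨hab, hτ0⟩
  have hq1 : q.1 = sheet k ((a₀, b), τ (a₀, b)) := rfl
  obtain ⟨κ, hκ, hball⟩ : ∃ κ > 0, ∀ a ∈ Metric.ball a₀ κ, ∀ z ∈ Metric.ball q κ,
      (a, b) ∈ params r ∧ timeCoord a b z ∈ Ioo (-δ) δ ∧ z.1 ∈ Ioo (-(5 / 2) : ℝ) (-(3 / 2)) := by
    have h1 : ContinuousAt (fun p : ℝ × (ℝ × ℝ) => (p.1, b)) (a₀, q) := by fun_prop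
    have h2 := (continuous_timeCoord b).continuousAt (x := (a₀, q))
    have h3 : ContinuousAt (fun p : ℝ × (ℝ × ℝ) => p.2.1) (a₀, q) := by fun_prop
    have e1 := h1.eventually ((isOpen_params r).mem_nhds hab)
    have e2 := h2.eventually (isOpen_Ioo.mem_nhds (by
      simp only [hq, timeCoord_phi hb]
      exact hτ0 : timeCoord a₀ b q ∈ Ioo (-δ) δ))
    have e3 := h3.eventually (isOpen_Ioo.mem_nhds (by
      simp only [hq1]
      exact hk.sheet_mem _ (hsub hmem0) : q.1 ∈ Ioo (-(5 / 2) : ℝ) (-(3 / 2))))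
    obtain ⟨κ, hκ, h⟩ := Metric.eventually_nhds_iff_ball.1 (e1.and (e2.and e3))
    refine ⟨κ, hκ, fun a ha z hz => h (a, z) ?_⟩
    rw [← ball_prod_same]
    exact ⟨ha, hz⟩
  rw [Real.ball_eq_Ioo] at hball
  set J := Ioo (a₀ - κ) (a₀ + κ) with hJ
  have ha₀ : a₀ ∈ J := ⟨by linarith, by linarith⟩
  have hqO : q ∈ Metric.ball q κ := Metric.mem_ball_self hκ
  have hJr : ∀ a ∈ J, (a, b) ∈ params r := fun a ha => (hball a ha q hqO).1
  have hJV : ∀ a ∈ J, ∀ t ∈ Icc (-δ) δ, ((a, b), t) ∈ params r ×ˢ Ioo (-(2 * δ)) (2 * δ) :=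
    fun a ha t ht => ⟨hJr a ha, by simp only; linarith [ht.1], by simp only; linarith [ht.2]⟩
  have hJp : ∀ a ∈ J, (a, b) ∈ params (1 / 50) := fun a ha =>
    hk.mem_params _ (hJV a ha 0 ⟨by linarith, by linarith⟩)
  have hψmono : ∀ a ∈ J, StrictMonoOn (fun t => ψ ((a, b), t)) (Ioo (-δ) δ) := by
    intro a ha
    have hd : ∀ t ∈ Ioo (-δ) δ, HasDerivAt (fun t => ψ ((a, b), t)) (tDeriv ψ ((a, b), t)) t :=
      fun t ht => hasDerivAt_of_contDiffOn hWo hψ ⟨hJr a ha, ht⟩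
    refine strictMonoOn_of_deriv_pos (convex_Ioo _ _)
      (fun t ht => (hd t ht).continuousAt.continuousWithinAt) fun t ht => ?_
    rw [interior_Ioo] at ht
    rw [(hd t ht).deriv]
    exact ((hψ' _ (hJr a ha)).2 t ht).2
  refine ⟨κ, Metric.ball q κ,
    fun a z => (ψ ((a, b), timeCoord a b z), z.2 - eta ((a, b), z.1)),
    fun a s => (-2 + 1 / 2 * s, eta ((a, b), -2 + 1 / 2 * s)),
    fun a s => phi a b (0 + δ * s, sheet k ((a, b), 0 + δ * s)), -1,
    fun a => sheetTheta k ((a, b), τ (a, b)), hκ, ⟨Metric.isOpen_ball, ?_, fun a ha => ⟨?_, ?_⟩⟩,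
    hqO, ?_, by norm_num, isArcFamily_eta hJp, hk.isArcFamily hb hδ hJV, ?_, hH0, hH1,
    fun a ha => ⟨?_, ?_⟩⟩
  · refine ContDiffOn.of_le (n := ∞) ?_ three_le_infty
    refine ContDiffOn.prodMk ?_ (ContDiffOn.sub contDiff_snd.snd.contDiffOn ?_)
    · refine hψ.comp (ContDiff.contDiffOn
        ((by fun_prop : ContDiff ℝ ∞ fun p : ℝ × (ℝ × ℝ) => (p.1, b)).prodMk
          (contDiff_timeCoord b))) fun p hp => ?_
      have := hball _ hp.1 _ hp.2
      exact ⟨this.1, this.2.1⟩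
    · refine contDiffOn_eta.comp (by fun_prop : ContDiff ℝ ∞ fun p : ℝ × (ℝ × ℝ) =>
        ((p.1, b), p.2.1)).contDiffOn fun p hp => ?_
      have := (hball _ hp.1 _ hp.2).2.2
      exact ⟨hJp _ hp.1, by simp only; linarith [this.1], by simp only; linarith [this.2]⟩
  -- `ψ` determines the time. At a fixed time the height is `z.1 ^ 2 - eta` up to a constant, which
  -- is injective in `z.1`; time and abscissa determine the point.
  · intro z hz z' hz' h
    have h1 := (hψmono a ha).injOn (hball a ha z hz).2.1 (hball a ha z' hz').2.1
      (congrArg Prod.fst h)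
    have h2 := congrArg Prod.snd h
    simp only at h2
    have e1 := eq_of_timeCoord (a := a) hb z
    have e2 := eq_of_timeCoord (a := a) hb z'
    rw [h1] at e1
    have h3 : z.1 = z'.1 := sq_sub_eta_inj (hJp a ha) (hball a ha z hz).2.2 (hball a ha z' hz').2.2
      (by linarith)
    refine Prod.ext h3 ?_
    rw [e1, e2, h3]
  · intro z hz
    obtain ⟨h1, h2, h3⟩ := hball a ha z hz
    have hx : z.1 ∈ Ioo (-3 : ℝ) 3 := ⟨by linarith [h3.1], by linarith [h3.2]⟩
    have d1 := (hasDerivAt_of_contDiffOn hWo hψ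
      (show ((a, b), timeCoord a b z) ∈ _ from ⟨h1, h2⟩)).comp_hasFDerivAt z
      (hasFDerivAt_timeCoord a b z)
    have d2 := (hasDerivAt_of_contDiffOn isOpen_stableDom contDiffOn_eta
      (show ((a, b), z.1) ∈ stableDom from ⟨hJp a ha, hx⟩)).comp_hasFDerivAt z
      (hasFDerivAt_fst (𝕜 := ℝ) (p := z))
    have d3 := d1.prodMk ((hasFDerivAt_snd (𝕜 := ℝ) (p := z)).sub d2)
    have hψpos := ((hψ' _ h1).2 _ h2).2
    have hη := abs_le.1 (abs_tDeriv_eta_le (hJp a ha) hx)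
    have d4 : HasFDerivAt (fun z : ℝ × ℝ =>
        (ψ ((a, b), timeCoord a b z), z.2 - eta ((a, b), z.1))) _ z := d3
    rw [d4.fderiv]
    -- A kernel vector has slope `2 z.1` from the first coordinate and slope `eta'` from the second.
    -- These differ, as `2 z.1 < -3` and `|eta'| ≤ 1`.
    refine bijective_of_injective fun v hv => ?_
    have e1 := congrArg Prod.fst hv
    have e2 := congrArg Prod.snd hv
    simp only [ContinuousLinearMap.prod_apply, smul_apply, sub_apply,
      ContinuousLinearMap.coe_fst', ContinuousLinearMap.coe_snd', smul_eq_mul, Prod.fst_zero,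
      Prod.snd_zero] at e1 e2
    have e3 : 2 * z.1 * v.1 - v.2 = 0 :=
      ((mul_eq_zero.1 e1).resolve_left hψpos.ne' |> mul_eq_zero.1).resolve_left (inv_ne_zero hb)
    have e4 : (2 * z.1 - tDeriv eta ((a, b), z.1)) * v.1 = 0 := by linarith
    have e5 : v.1 = 0 := (mul_eq_zero.1 e4).resolve_left (by linarith [h3.2, hη.1])
    refine Prod.ext e5 ?_
    rw [e5] at e3
    simp only [Prod.snd_zero]
    linarith
  · simp only [hq, timeCoord_phi hb, (hψ' _ hab).1]
    refine Prod.ext rfl ?_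
    simpa [phi, sheetTheta] using hH0
  · exact (hH.comp (by fun_prop : ContDiff ℝ ∞ fun a : ℝ => (a, b)).contDiffOn hJr).of_le
      (by exact_mod_cast le_top)
  · ext z
    constructor
    · rintro ⟨⟨s, hs, rfl⟩, hz⟩
      exact ⟨hz, by simp⟩
    · rintro ⟨hz, h0⟩
      have hx := (hball a ha z hz).2.2
      refine ⟨⟨2 * (z.1 + 2), ⟨by linarith [hx.1], by linarith [hx.2]⟩, ?_⟩, hz⟩
      simp only at h0
      have e : -2 + 1 / 2 * (2 * (z.1 + 2)) = z.1 := by ring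
      simp only [e]
      exact Prod.ext rfl (by simp only; linarith)
  · ext z
    constructor
    · rintro ⟨⟨s, hs, rfl⟩, hz⟩
      refine ⟨hz, ?_⟩
      have ht := (hball a ha _ hz).2.1
      simp only [timeCoord_phi hb] at ht ⊢
      have h1 := ((hψ' _ (hJr a ha)).2 _ ht).1
      rw [h1]
      simp only [phi, sheetTheta]
      ring
    · rintro ⟨hz, h0⟩
      obtain ⟨h1, h2, h3⟩ := hball a ha z hz
      have h4 := ((hψ' _ h1).2 _ h2).1
      simp only [h4] at h0
      have h5 := eq_of_timeCoord (a := a) hb z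
      have hV := hJV a ha _ (Ioo_subset_Icc_self h2)
      -- The point `z` and the point of the arc with the same time have equal heights, hence equal
      -- abscissas, so they coincide.
      have h6 : z.1 = sheet k ((a, b), timeCoord a b z) := by
        refine sq_sub_eta_inj (hJp a ha) h3 (hk.sheet_mem _ hV) ?_
        have h7 : sheetTheta k ((a, b), timeCoord a b z) = a - b * timeCoord a b z +
          sheet k ((a, b), timeCoord a b z) ^ 2 - eta ((a, b), sheet k ((a, b), timeCoord a b z)) :=
          rfl
        linarith
      refine ⟨⟨timeCoord a b z / δ, ⟨?_, ?_⟩, ?_⟩, hz⟩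
      · rw [le_div_iff₀ hδ]
        linarith [h2.1]
      · rw [div_le_iff₀ hδ]
        linarith [h2.2]
      · have e : 0 + δ * (timeCoord a b z / δ) = timeCoord a b z := by
          field_simp
          ring
        simp only [e, phi, ← h6]
        exact Prod.ext rfl h5.symm

/-! ### Choice of the domains and the derivative of the fixed point -/

theorem sqrt_nine : √(9 : ℝ) = 3 := by
  rw [show (9 : ℝ) = 3 ^ 2 by norm_num]
  exact Real.sqrt_sq (by norm_num)

theorem yFix_base : yFix (-2) 0 = 2 := by
  rw [yFix]
  norm_num [sqrt_nine]

/-- The choice of the domains. -/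
theorem exists_setup : ∃ (k k₁ k₂ : (ℝ × ℝ) × ℝ → ℝ) (τ : ℝ × ℝ → ℝ) (r δ : ℝ),
    0 < r ∧ r ≤ 1 / 50 ∧ 0 < δ ∧
    (∀ κ ∈ ({k, k₁, k₂} : Set ((ℝ × ℝ) × ℝ → ℝ)),
      IsSheet κ (params r ×ˢ Ioo (-(2 * δ)) (2 * δ)) ∧ ∀ q ∈ params r, sheetTheta κ (q, δ) < 0) ∧
    (∀ v ∈ params r ×ˢ Ioo (-(2 * δ)) (2 * δ),
      k v ∈ Ioo (-(7 / 4) : ℝ) (-(5 / 4)) ∧ xi (v.1, k v) = v.2 ∧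
      (0 < v.1.2 → sheet k₁ v < sheet k v) ∧ (v.1.2 < 0 → sheet k₂ v < sheet k v)) ∧
    ContDiffOn ℝ ∞ τ (params r) ∧ τ (-2, 0) = 0 ∧
    ∀ q ∈ params r, τ q ∈ Ioo (-δ) δ ∧ tDeriv (sheetTheta k) (q, τ q) = 0 := by
  obtain ⟨k, k₁, k₂, V, hb, hk, hk₁, hk₂, hV⟩ := exists_sheets
  have hb0 : tDeriv (sheetTheta k) base = 0 := by
    rw [base, tDeriv_sheetTheta_zero hk.isOpen hk.smooth hk.mem_params
      (fun v hv => ⟨by linarith [(hk.sheet_mem v hv).1], by linarith [(hk.sheet_mem v hv).2]⟩) hb]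
    norm_num
  obtain ⟨τ, A, hA, hbA, hτ, hτ0, hτA⟩ := exists_implicit_real hk.isOpen
    (contDiffOn_tDeriv hk.isOpen hk.contDiffOn_theta) (p := ((-2 : ℝ), (0 : ℝ))) (x := 0) hb
    (hk.tDeriv_tDeriv_neg _ hb).ne
  obtain ⟨ρ, hρ, hρV⟩ := Metric.isOpen_iff.1 hk.isOpen base hb
  -- With `δ ≤ 1` the height at `base` parameters and `t = δ`, namely `δ⁴ - 4δ²`, is negative.
  -- Domains of half-width `2δ` contain the closed interval `[-δ, δ]` in their interior.
  set δ := min (ρ / 2) 1 with hδ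
  have hδ0 : 0 < δ := lt_min (by linarith) one_pos
  have hδ1 : δ ≤ 1 := min_le_right _ _
  have hδρ : 2 * δ ≤ ρ := by linarith [min_le_left (ρ / 2) 1]
  have hsub : ∀ r ≤ ρ, params r ×ˢ Ioo (-(2 * δ)) (2 * δ) ⊆ V := by
    intro r hr
    refine Subset.trans ?_ hρV
    rw [base, ← ball_prod_same, ← params_eq_ball, Real.ball_eq_Ioo]
    exact prod_mono (params_mono hr) (Ioo_subset_Ioo (by linarith) (by linarith))
  have hneg : ∀ κ, IsSheet κ V → ∀ᶠ q in 𝓝 ((-2 : ℝ), (0 : ℝ)), sheetTheta κ (q, δ) < 0 := by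
    intro κ hκ
    have hδV : (((-2 : ℝ), (0 : ℝ)), δ) ∈ V :=
      hsub ρ le_rfl ⟨base_mem_params hρ, by simp only; linarith, by simp only; linarith⟩
    have hval : sheetTheta κ ((-2, 0), δ) < 0 := by
      rw [sheetTheta_zero (hκ.mem_params _ hδV) ⟨by linarith [(hκ.sheet_mem _ hδV).1],
        by linarith [(hκ.sheet_mem _ hδV).2]⟩]
      rw [yFix_base]
      have h3 : 0 < δ ^ 2 := by positivity
      have h4 : δ ^ 2 ≤ 1 := by nlinarith
      nlinarith
    have hc : ContinuousAt (fun q : ℝ × ℝ => sheetTheta κ (q, δ)) (-2, 0) :=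
      (hκ.contDiffOn_theta.continuousOn.continuousAt (hκ.isOpen.mem_nhds hδV)).comp
        (f := fun q : ℝ × ℝ => (q, δ)) (by fun_prop)
    exact hc.eventually_lt continuousAt_const hval
  have hτc : ∀ᶠ q in 𝓝 ((-2 : ℝ), (0 : ℝ)), τ q ∈ Ioo (-δ) δ :=
    (hτ.continuousOn.continuousAt (hA.mem_nhds hbA)).eventually
      (isOpen_Ioo.mem_nhds (by rw [hτ0]; exact ⟨by linarith, hδ0⟩))
  obtain ⟨r₀, hr₀, hr₀'⟩ := Metric.eventually_nhds_iff_ball.1 ((hneg k hk).and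
    ((hneg k₁ hk₁).and ((hneg k₂ hk₂).and (hτc.and (hA.mem_nhds hbA)))))
  set r := min r₀ (min ρ (1 / 50)) with hr
  have hr1 : r ≤ r₀ := min_le_left _ _
  have hr2 : r ≤ ρ := (min_le_right _ _).trans (min_le_left _ _)
  have hr3 : r ≤ 1 / 50 := (min_le_right _ _).trans (min_le_right _ _)
  have hball : ∀ q ∈ params r, q ∈ Metric.ball ((-2 : ℝ), (0 : ℝ)) r₀ := fun q hq => by
    rw [← params_eq_ball]
    exact params_mono hr1 hq
  have ho : IsOpen (params r ×ˢ Ioo (-(2 * δ)) (2 * δ)) := (isOpen_params r).prod isOpen_Ioo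
  refine ⟨k, k₁, k₂, τ, r, δ, lt_min hr₀ (lt_min hρ (by norm_num)), hr3, hδ0, ?_,
    fun v hv => hV v (hsub r hr2 hv), hτ.mono fun q hq => (hr₀' q (hball q hq)).2.2.2.2, hτ0,
    fun q hq => ⟨(hr₀' q (hball q hq)).2.2.2.1, ?_⟩⟩
  · rintro κ (rfl | rfl | rfl)
    · exact ⟨hk.mono ho (hsub r hr2), fun q hq => (hr₀' q (hball q hq)).1⟩
    · exact ⟨hk₁.mono ho (hsub r hr2), fun q hq => (hr₀' q (hball q hq)).2.1⟩
    · exact ⟨hk₂.mono ho (hsub r hr2), fun q hq => (hr₀' q (hball q hq)).2.2.1⟩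
  · have := (hτA q (hr₀' q (hball q hq)).2.2.2.2).2
    rw [this]
    exact hb0

theorem hasDerivAt_yFix : HasDerivAt (fun a => yFix a 0) (-(1 / 3)) (-2) := by
  have h9 := sqrt_nine
  have h1 : HasDerivAt (fun a : ℝ => ((1 : ℝ) + 0) ^ 2 - 4 * a) (-4) (-2) := by
    exact (((hasDerivAt_id (-2 : ℝ)).const_mul 4).const_sub _).congr_deriv (by norm_num)
  have h2 := ((h1.sqrt (by norm_num)).const_add ((1 : ℝ) + 0)).div_const 2
  refine h2.congr_deriv ?_
  norm_num [h9]

end Henon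

end

/-! ### The tangency curve and the conclusion -/

theorem proposition3p1 :
    ∃ (r δ : ℝ) (η ξ ζ : ℝ → ℝ → ℝ → ℝ) (τ : ℝ → ℝ → ℝ),
      0 < r ∧ 0 < δ ∧
      Henon.IsStableGraph r η ∧ Henon.IsUnstableGraph r ξ ∧ Henon.IsReturnGraph r δ ξ ζ ∧
      Henon.IsTop r δ η ζ τ ∧
      (∀ a b, (a, b) ∈ Henon.params r → b ≠ 0 →
        Henon.IsDissipativeSaddle (Henon.phi a b) (Henon.pFix a b)) ∧
      ContDiffOn ℝ ∞ (fun v : ℝ × ℝ => Henon.height η ζ τ v.1 v.2) (Henon.params r) ∧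
      ContDiffOn ℝ ∞ (fun v : ℝ × ℝ => Henon.qPoint ζ τ v.1 v.2) (Henon.params r) ∧
      Henon.qPoint ζ τ (-2) 0 = (-2, 2) ∧
      ∃ (ε : ℝ) (h : ℝ → ℝ),
        0 < ε ∧ ContDiffOn ℝ ∞ h (Ioo (-ε) ε) ∧ h 0 = -2 ∧
        ∀ b ∈ Ioo (-ε) ε,
          (h b, b) ∈ Henon.params r ∧
          Henon.height η ζ τ (h b) b = 0 ∧
          deriv (fun a => Henon.height η ζ τ a b) (h b) ≠ 0 ∧
          deriv (deriv (Henon.theta η ζ (h b) b)) (τ (h b) b) ≠ 0 ∧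
          (b ≠ 0 →
            (∃ z, z ≠ Henon.pFix (h b) b ∧
              Henon.IsTransverseIntersection (Henon.Wu (h b) b) (Henon.Ws (h b) b) z) ∧
            Henon.IsQuadraticTangency (Henon.Ws (h b) b) (Henon.Wu (h b) b)
              (Henon.qPoint ζ τ (h b) b) ∧
            Henon.UnfoldsGenerically (fun a => Henon.Ws a b) (fun a => Henon.Wu a b) (h b)
              (Henon.qPoint ζ τ (h b) b)) := by
  obtain ⟨k, k₁, k₂, τ, r, δ, hr, hr50, hδ, hsheets, hkV, hτ, hτ0, hτq⟩ := Henon.exists_setup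
  set V := Henon.params r ×ˢ Ioo (-(2 * δ)) (2 * δ) with hVdef
  have hk : Henon.IsSheet k V := (hsheets k (by simp)).1
  have hIV : ∀ {q t}, q ∈ Henon.params r → t ∈ Icc (-δ) δ → (q, t) ∈ V := fun hq ht =>
    ⟨hq, by simp only; linarith [ht.1], by simp only; linarith [ht.2]⟩
  have hτV : ∀ {q}, q ∈ Henon.params r → (q, τ q) ∈ V := fun hq =>
    hIV hq (Ioo_subset_Icc_self (hτq _ hq).1)
  have hgraph : ContDiffOn ℝ ∞ (fun q => (q, τ q)) (Henon.params r) := contDiffOn_id.prodMk hτ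
  have hH : ContDiffOn ℝ ∞ (fun q => Henon.sheetTheta k (q, τ q)) (Henon.params r) :=
    hk.contDiffOn_theta.comp hgraph fun q hq => hτV hq
  have hbase : ((-2 : ℝ), (0 : ℝ)) ∈ Henon.params r := Henon.base_mem_params hr
  have hs3 : ∀ v ∈ V, Henon.sheet k v ∈ Ioo (-3 : ℝ) 3 := fun v hv =>
    ⟨by linarith [(hk.sheet_mem v hv).1], by linarith [(hk.sheet_mem v hv).2]⟩
  -- At `b = 0` the height is even in `t`, so `t = 0` is critical, and concavity makes it the only
  -- critical point.
  have hτzero : ∀ a, (a, (0 : ℝ)) ∈ Henon.params r → τ (a, 0) = 0 := by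
    intro a ha
    have h0 : (0 : ℝ) ∈ Icc (-δ) δ := ⟨by linarith, hδ.le⟩
    refine (hk.strictAntiOn_tDeriv (q := (a, 0)) (convex_Icc (-δ) δ) fun s hs => hIV ha hs).injOn
      (Ioo_subset_Icc_self (hτq _ ha).1) h0 ?_
    simp only [(hτq _ ha).2]
    rw [Henon.tDeriv_sheetTheta_zero hk.isOpen hk.smooth hk.mem_params hs3 (hIV ha h0)]
    ring
  have hHzero : ∀ a, (a, (0 : ℝ)) ∈ Henon.params r →
      Henon.sheetTheta k ((a, 0), τ (a, 0)) = a + a ^ 2 - Henon.yFix a 0 := by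
    intro a ha
    rw [Henon.sheetTheta_zero (hk.mem_params _ (hτV ha)) (hs3 _ (hτV ha)), hτzero a ha]
    ring
  -- The parameters are swapped to `(b, a)`, because `exists_implicit_real` solves for the last
  -- variable.
  set U : Set (ℝ × ℝ) := {p | (p.2, p.1) ∈ Henon.params r} with hU
  have hUo : IsOpen U := (Henon.isOpen_params r).preimage continuous_swap
  set F : ℝ × ℝ → ℝ := fun p => Henon.sheetTheta k ((p.2, p.1), τ (p.2, p.1)) with hF
  have hFs : ContDiffOn ℝ ∞ F U :=
    hH.comp (contDiff_snd.prodMk contDiff_fst).contDiffOn fun p hp => hp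
  -- The derivative of `a + a² - y_{a,0}` at `-2` is `1 - 4 + 1/3`.
  have hFd : Henon.tDeriv F (0, -2) = -(8 / 3) := by
    refine Henon.tDeriv_eq_of_hasDerivAt hUo hFs hbase ?_
    have h1 := ((hasDerivAt_id (-2 : ℝ)).add (hasDerivAt_pow 2 (-2 : ℝ))).sub Henon.hasDerivAt_yFix
    refine (h1.congr_deriv (by norm_num)).congr_of_eventuallyEq ?_
    have hc : ContinuousAt (fun a : ℝ => (a, (0 : ℝ))) (-2) := by fun_prop
    filter_upwards [hc.eventually ((Henon.isOpen_params r).mem_nhds hbase)] with a ha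
    exact hHzero a ha
  -- Solving inside this set yields `∂H/∂a ≠ 0` along the whole curve.
  set U' := U ∩ {p | Henon.tDeriv F p ≠ 0} with hU'
  have hU'o : IsOpen U' := (Henon.contDiffOn_tDeriv hUo hFs).continuousOn.isOpen_inter_preimage hUo
    isOpen_ne
  obtain ⟨h, B, hB, h0B, hh, hh0, hhB⟩ := Henon.exists_implicit_real hU'o
    (hFs.mono inter_subset_left) (p := (0 : ℝ)) (x := -2)
    ⟨hbase, by simp only [mem_ofPred_eq, hFd]; norm_num⟩ (by rw [hFd]; norm_num)
  obtain ⟨ε, hε, hεB⟩ := Metric.isOpen_iff.1 hB 0 h0B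
  rw [Real.ball_eq_Ioo, zero_sub, zero_add] at hεB
  refine ⟨r, δ, fun a b x => Henon.eta ((a, b), x), fun a b x => Henon.xi ((a, b), x),
    fun a b t => Henon.sheet k ((a, b), t), fun a b => τ (a, b), hr, hδ,
    Henon.isStableGraph hr50, Henon.isUnstableGraph hr50, ⟨?_, fun a b hab t ht => ?_⟩,
    fun a b hab => ⟨fun t ht => hk.mem_Icc (hIV hab ht), (hτq _ hab).1, fun t ht hne => ?_⟩,
    fun a b hab hb => Henon.isDissipativeSaddle (Henon.params_mono hr50 hab) hb, hH, ?_, ?_,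
    ε, h, hε, hh.mono hεB, hh0, fun b hb => ?_⟩
  · exact (Henon.contDiffOn_sheet hk.smooth).mono fun v hv => hIV hv.1 hv.2
  · obtain ⟨h1, h2, -⟩ := hkV _ (hIV hab ht)
    refine ⟨k ((a, b), t), Ioo_subset_Icc_self h1, ?_⟩
    simp only at h2
    simp only [Henon.phi, h2, Henon.sheet]
  · exact hk.theta_lt (convex_Icc (-δ) δ) (fun s hs => hIV hab hs)
      (Ioo_subset_Icc_self (hτq _ hab).1) (hτq _ hab).2 ht hne
  · have h1 : ContDiffOn ℝ ∞ (fun q => Henon.sheet k (q, τ q)) (Henon.params r) :=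
      (Henon.contDiffOn_sheet hk.smooth).comp hgraph fun q hq => hτV hq
    exact h1.prodMk ((contDiff_fst.contDiffOn.sub (contDiff_snd.contDiffOn.mul hτ)).add (h1.pow 2))
  · simp only [Henon.qPoint, hτ0, Henon.phi, Henon.sheet]
    norm_num
  · obtain ⟨⟨hbU, hbd⟩, hbF⟩ := hhB b (hεB hb)
    have hF0 : F (0, -2) = 0 := by
      have := hHzero (-2) hbase
      simp only [hF, this, Henon.yFix_base]
      norm_num
    have hHb : Henon.sheetTheta k ((h b, b), τ (h b, b)) = 0 := hbF.trans hF0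
    have hdb : deriv (fun a => Henon.sheetTheta k ((a, b), τ (a, b))) (h b) ≠ 0 := by
      rw [(Henon.hasDerivAt_of_contDiffOn hUo hFs hbU : HasDerivAt
        (fun a => Henon.sheetTheta k ((a, b), τ (a, b))) _ (h b)).deriv]
      exact hbd
    have hunf : b ≠ 0 → _ := fun hb0 => Henon.unfoldsGenerically hδ hk hτ (fun q hq => (hτq q hq).1)
      (fun q hq => (hτq q hq).2) hH hb0 hbU hHb hdb
    refine ⟨hbU, hHb, hdb, ?_, fun hb0 => ⟨?_, (hunf hb0).isQuadraticTangency, hunf hb0⟩⟩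
    · have hev : deriv (fun t => Henon.sheetTheta k ((h b, b), t)) =ᶠ[𝓝 (τ (h b, b))]
          fun t => Henon.tDeriv (Henon.sheetTheta k) ((h b, b), t) := by
        filter_upwards [isOpen_Ioo.mem_nhds (hτq _ hbU).1] with t ht
        exact (hk.hasDerivAt_theta (hIV hbU (Ioo_subset_Icc_self ht))).deriv
      have h2 : deriv (deriv (fun t => Henon.sheetTheta k ((h b, b), t))) (τ (h b, b)) =
          Henon.tDeriv (Henon.tDeriv (Henon.sheetTheta k)) ((h b, b), τ (h b, b)) := by
        rw [hev.deriv_eq]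
        exact (Henon.hasDerivAt_of_contDiffOn hk.isOpen
          (Henon.contDiffOn_tDeriv hk.isOpen hk.contDiffOn_theta) (hτV hbU)).deriv
      exact h2.trans_ne (hk.tDeriv_tDeriv_neg _ (hτV hbU)).ne
    -- As `x² - eta` decreases on the relevant interval, a sheet below the tangent one at the top
    -- time has positive height there; at `t = δ` its height is negative.
    · have key : ∀ κ ∈ ({k, k₁, k₂} : Set ((ℝ × ℝ) × ℝ → ℝ)),
          Henon.sheet κ ((h b, b), τ (h b, b)) < Henon.sheet k ((h b, b), τ (h b, b)) →
          ∃ z, z ≠ Henon.pFix (h b) b ∧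
            Henon.IsTransverseIntersection (Henon.Wu (h b) b) (Henon.Ws (h b) b) z := by
        intro κ hκ hlt
        obtain ⟨hs, hneg⟩ := hsheets κ hκ
        refine hs.exists_transverse (q := (h b, b)) (hτq _ hbU).1.2 (fun t ht => hIV hbU
          ⟨(hτq _ hbU).1.1.le.trans ht.1, ht.2⟩) ?_ (hneg _ hbU)
        have h1 := Henon.sq_sub_eta_lt (Henon.params_mono hr50 hbU) (hs.sheet_mem _ (hτV hbU))
          (hk.sheet_mem _ (hτV hbU)) hlt
        simp only [Henon.sheetTheta] at hHb ⊢
        linarith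
      rcases lt_or_gt_of_ne hb0 with hneg | hpos
      · exact key k₂ (by simp) ((hkV _ (hτV hbU)).2.2.2 hneg)
      · exact key k₁ (by simp) ((hkV _ (hτV hbU)).2.2.1 hpos)
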